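/- Setting. Observations $x_1,\dots,x_n$ are i.i.d. from $P$, the law with density $f(\cdot,\phi^*)$ with respect to a dominating measure $\nu$. The parameter is $\omega=(\phi,\psi)\in\mathbb R^s$ with $\phi\in\mathbb R^r$, $\psi\in\mathbb R^{s-r}$, $s-r\le t\le r$; the log-likelihood is $\ell(x,\phi)=\sum_{i=1}^n\log f(x_i,\phi)$, with score $s(x,\phi)=\partial\ell/\partial\phi$ and Hessian $M_{x,\phi}$. The true value $\omega^*=(\phi^*,\psi^*)$ satisfies the constraints $h(\omega)=0$, $h=(h_1,\dots,h_t)$. Write $J_\omega=(\partial h_j/\partial\phi_i)\in\mathbb R^{r\times t}$, $K_\omega=(\partial h_j/\partial\psi_i)\in\mathbb R^{(s-r)\times t}$, $U_\alpha=\{\omega:\|\omega-\omega^*\|\le\alpha\}$ with $\alpha>0$, and $B=E[\partial_\phi\log f(x_1,\phi^*)\,\partial_\phi\log f(x_1,\phi^*)^T]$. Conditions on $f$, for all $\phi$ with $\|\phi-\phi^*\|\le\alpha$: the densities $f(\cdot,\phi)$ have a common support; for almost every observation the partial derivatives of $\log f$ in $\phi$ up to order three exist; the first and second derivatives of $f$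 are dominated in absolute value by $\nu$-integrable functions, and the third derivatives of $\log f$ by a function $F_3$ with $E[F_3]\le\kappa_1$, $\kappa_1>0$; $B$ is finite and positive definite. Conditions on $h$, on $U_\alpha$: first partial derivatives exist and are continuous; second partial derivatives exist and are bounded by $2\kappa_2$; $\operatorname{rank}J_{\omega^*}=t$ and $\operatorname{rank}K_{\omega^*}=s-r$. Estimators. Let $\delta_m\downarrow0$, $\epsilon_m\downarrow0$ with $0<\delta_m<\alpha$, $0<\epsilon_m<1$, let $n_1<n_2<\dots$ be integers and, for $n_m\le n<n_{m+1}$, let $\mathbf X_n$ be an event (a set of samples of size $n$) such that $\Pr\{\mathbf X_n\}>1-\epsilon_m$ and, for $x\in\mathbf X_n$: $\|s(x,\phi^*)/n\|<\delta_m^2$; $M_{x,\phi^*}/n=-B+\delta_m m_x$ with all entries of $m_x$ bounded by $1$ in modulus; and all third partial derivatives of $\ell(x,\cdot)/n$ are less than $2\kappa_1$ in modulus for $\|\phi-\phi^*\|\le\alpha$. For $x\in\mathbf X_n$ let $(\hat\omega_n,\hat\lambda_n)$ be a solution of $$\tfrac1n s(x,\phi)+J_\omega\lambda=0,\qquad K_\omega\lambda=0,\qquad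 h(\omega)=0$$ with $\|\hat\omega_n-\omega^*\|<\delta_m$; for $x\notin\mathbf X_n$ put $$\begin{pmatrix}\hat\phi_n-\phi^*\\ \hat\psi_n-\psi^*\\ \hat\lambda_n\end{pmatrix}=\big(P_{ij}\big)_{i,j=1}^3\begin{pmatrix}\tfrac1n s(x,\phi^*)\\0\\0\end{pmatrix},$$ where, with $J=J_{\omega^*}$, $K=K_{\omega^*}$, $A=(J^TB^{-1}J)^{-1}$, $S=(KAK^T)^{-1}$, $$P_{11}=B^{-1}-B^{-1}JAJ^TB^{-1}+B^{-1}JAK^TSKAJ^TB^{-1},\quad P_{12}=-B^{-1}JAK^TS,\quad P_{13}=-B^{-1}JA+B^{-1}JAK^TSKA,$$ $$P_{22}=S,\quad P_{23}=-SKA,\quad P_{33}=-A+AK^TSKA,\quad P_{21}=P_{12}^T,\ P_{31}=P_{13}^T,\ P_{32}=P_{23}^T.$$ Theorem. The matrix $$\begin{pmatrix}B&0&-J\\0&0&-K\\-J^T&-K^T&0\end{pmatrix}$$ is nonsingular with inverse $(P_{ij})$, and for every such sequence of (measurable) estimators $$\sqrt n\begin{pmatrix}\hat\phi_n-\phi^*\\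 \hat\psi_n-\psi^*\\ \hat\lambda_n\end{pmatrix}\xrightarrow{d}\mathcal N_{s+t}\left(0,\begin{pmatrix}P_{11}&P_{12}&0\\P_{21}&P_{22}&0\\0&0&-P_{33}\end{pmatrix}\right),$$ the limiting covariance matrix being positive semidefinite. -/

import Mathlib

open MeasureTheory ProbabilityTheory Filter Topology Matrix

noncomputable section

namespace PartialID

/-- The partial derivative `∂g/∂ω_i` at `ω`. -/
def pd {ι : Type*} [DecidableEq ι] (g : EuclideanSpace ℝ ι → ℝ) (i : ι)
    (ω : EuclideanSpace ℝ ι) : ℝ :=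
  lineDeriv ℝ g ω (EuclideanSpace.single i 1)

/-- The partial derivative `∂g/∂ω_i` exists at `ω`. -/
def HasPD {ι : Type*} [DecidableEq ι] (g : EuclideanSpace ℝ ι → ℝ) (i : ι)
    (ω : EuclideanSpace ℝ ι) : Prop :=
  LineDifferentiableAt ℝ g ω (EuclideanSpace.single i 1)

section Model

variable {𝒳 : Type*} {r q t : ℕ}

/-- The identified part `φ` (the first `r` coordinates) of `ω = (φ, ψ)`. -/
def phiPart (ω : EuclideanSpace ℝ (Fin r ⊕ Fin q)) : EuclideanSpace ℝ (Fin r) :=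
  WithLp.toLp 2 fun i => ω (Sum.inl i)

/-- The log-likelihood `ℓ(x, φ) = ∑ log f(x_i, φ)` of a sample of size `n`. -/
def logLik (f : 𝒳 → EuclideanSpace ℝ (Fin r) → ℝ) {n : ℕ} (x : Fin n → 𝒳)
    (φ : EuclideanSpace ℝ (Fin r)) : ℝ :=
  ∑ k, Real.log (f (x k) φ)

/-- The score vector `s(x, φ) = (∂ℓ(x, φ)/∂φ_i)_i`. -/
def score (f : 𝒳 → EuclideanSpace ℝ (Fin r) → ℝ) {n : ℕ} (x : Fin n → 𝒳)
    (φ : EuclideanSpace ℝ (Fin r)) : EuclideanSpace ℝ (Fin r) :=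
  WithLp.toLp 2 fun i => pd (logLik f x) i φ

/-- The Hessian `M_{x, φ} = (∂²ℓ(x, φ)/∂φ_i∂φ_j)_{i,j}`. -/
def hess (f : 𝒳 → EuclideanSpace ℝ (Fin r) → ℝ) {n : ℕ} (x : Fin n → 𝒳)
    (φ : EuclideanSpace ℝ (Fin r)) : Matrix (Fin r) (Fin r) ℝ :=
  Matrix.of fun i j => pd (pd (logLik f x) i) j φ

/-- The Fisher information matrix of one observation with law `P`, at the parameter `φ`. -/
def fisherInfo [MeasurableSpace 𝒳] (P : Measure 𝒳) (f : 𝒳 → EuclideanSpace ℝ (Fin r) → ℝ)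
    (φ : EuclideanSpace ℝ (Fin r)) : Matrix (Fin r) (Fin r) ℝ :=
  Matrix.of fun i j =>
    ∫ y, pd (fun φ' => Real.log (f y φ')) i φ * pd (fun φ' => Real.log (f y φ')) j φ ∂P

/-- `J_ω = (∂h_j(ω)/∂φ_i)`, of size `r × t`. -/
def jacJ (h : EuclideanSpace ℝ (Fin r ⊕ Fin q) → Fin t → ℝ)
    (ω : EuclideanSpace ℝ (Fin r ⊕ Fin q)) : Matrix (Fin r) (Fin t) ℝ :=
  Matrix.of fun i j => pd (fun w => h w j) (Sum.inl i) ω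

/-- `K_ω = (∂h_j(ω)/∂ψ_i)`, of size `(s - r) × t`, where `q = s - r`. -/
def jacK (h : EuclideanSpace ℝ (Fin r ⊕ Fin q) → Fin t → ℝ)
    (ω : EuclideanSpace ℝ (Fin r ⊕ Fin q)) : Matrix (Fin q) (Fin t) ℝ :=
  Matrix.of fun i j => pd (fun w => h w j) (Sum.inr i) ω

/-- Regularity conditions on the densities `f(·, φ)` (with respect to a dominating measure `ν`)
on the ball of radius `α` around the true value `φ₀`; `P` is the law with density `f(·, φ₀)`. -/
structure DensityConditions [MeasurableSpace 𝒳] (ν P : Measure 𝒳)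
    (f : 𝒳 → EuclideanSpace ℝ (Fin r) → ℝ) (φ₀ : EuclideanSpace ℝ (Fin r)) (α κ₁ : ℝ) :
    Prop where
  measurable : ∀ φ ∈ Metric.closedBall φ₀ α, Measurable fun y => f y φ
  nonneg : ∀ φ ∈ Metric.closedBall φ₀ α, ∀ y, 0 ≤ f y φ
  lintegral_eq_one : ∀ φ ∈ Metric.closedBall φ₀ α, ∫⁻ y, ENNReal.ofReal (f y φ) ∂ν = 1
  /-- `P` is the true distribution of one observation. -/
  law : P = ν.withDensity fun y => ENNReal.ofReal (f y φ₀)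
  /-- The densities have a common support, so that the log-densities make sense there. -/
  support : ∀ᵐ y ∂ν, ∀ φ ∈ Metric.closedBall φ₀ α, (0 < f y φ ↔ 0 < f y φ₀)
  /-- For almost all observations `log f` has partial derivatives up to the third order. -/
  exists_deriv : ∀ᵐ y ∂P, ∀ φ ∈ Metric.closedBall φ₀ α,
    (∀ i, HasPD (fun φ' => Real.log (f y φ')) i φ) ∧
    (∀ i j, HasPD (pd (fun φ' => Real.log (f y φ')) i) j φ) ∧
    (∀ i j k, HasPD (pd (pd (fun φ' => Real.log (f y φ')) i) j) k φ)
  /-- The first and second derivatives of `f` are dominated by integrable functions. -/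
  dominated : ∃ F₁ F₂ : 𝒳 → ℝ, Integrable F₁ ν ∧ Integrable F₂ ν ∧
    ∀ᵐ y ∂P, ∀ φ ∈ Metric.closedBall φ₀ α,
      (∀ i, |pd (f y) i φ| ≤ F₁ y) ∧ (∀ i j, |pd (pd (f y) i) j φ| ≤ F₂ y)
  /-- The third derivatives of `log f` are dominated by a function of bounded expectation. -/
  third_dominated : ∃ F₃ : 𝒳 → ℝ, Integrable F₃ P ∧ ∫ y, F₃ y ∂P ≤ κ₁ ∧
    ∀ᵐ y ∂P, ∀ φ ∈ Metric.closedBall φ₀ α,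
      ∀ i j k, |pd (pd (pd (fun φ' => Real.log (f y φ')) i) j) k φ| ≤ F₃ y
  kappa_pos : 0 < κ₁
  /-- The information matrix at the true value is finite ... -/
  info_finite : ∀ i, MemLp (fun y => pd (fun φ' => Real.log (f y φ')) i φ₀) 2 P
  /-- ... and positive definite. -/
  info_posDef : (fisherInfo P f φ₀).PosDef

/-- Conditions on the constraint function `h` on the ball `U_α` around the true value `ω₀`. -/
structure ConstraintConditions (h : EuclideanSpace ℝ (Fin r ⊕ Fin q) → Fin t → ℝ)
    (ω₀ : EuclideanSpace ℝ (Fin r ⊕ Fin q)) (α κ₂ : ℝ) : Prop where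
  exists_deriv : ∀ k i, ∀ ω ∈ Metric.closedBall ω₀ α, HasPD (fun w => h w k) i ω
  continuous_deriv : ∀ k i, ContinuousOn (pd (fun w => h w k) i) (Metric.closedBall ω₀ α)
  exists_second_deriv : ∀ k i j, ∀ ω ∈ Metric.closedBall ω₀ α,
    HasPD (pd (fun w => h w k) i) j ω
  second_deriv_bound : ∀ k i j, ∀ ω ∈ Metric.closedBall ω₀ α,
    |pd (pd (fun w => h w k) i) j ω| ≤ 2 * κ₂
  rank_J : (jacJ h ω₀).rank = t
  rank_K : (jacK h ω₀).rank = q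

/-- The defining properties of the sets `X_n` of well-behaved samples of size `n`,
for given `δ` and `ε`. -/
structure IsGoodSet [MeasurableSpace 𝒳] (P : Measure 𝒳) [IsProbabilityMeasure P]
    (f : 𝒳 → EuclideanSpace ℝ (Fin r) → ℝ) (φ₀ : EuclideanSpace ℝ (Fin r)) (α κ₁ δ ε : ℝ)
    {n : ℕ} (X : Set (Fin n → 𝒳)) : Prop where
  measurableSet : MeasurableSet X
  prob : 1 - ε < (Measure.pi fun _ : Fin n => P).real X
  score_lt : ∀ x ∈ X, ‖(n : ℝ)⁻¹ • score f x φ₀‖ < δ ^ 2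
  hess_eq : ∀ x ∈ X, ∃ m : Matrix (Fin r) (Fin r) ℝ, (∀ i j, |m i j| ≤ 1) ∧
    (n : ℝ)⁻¹ • hess f x φ₀ = -fisherInfo P f φ₀ + δ • m
  third_lt : ∀ x ∈ X, ∀ φ ∈ Metric.closedBall φ₀ α, ∀ i j k,
    |(n : ℝ)⁻¹ * pd (pd (pd (logLik f x) i) j) k φ| < 2 * κ₁

/-- `(ω, lam)` solves the Lagrange equations
`s(x, φ)/n + J_ω lam = 0`, `K_ω lam = 0`, `h(ω) = 0`. -/
structure SolvesLagrange (f : 𝒳 → EuclideanSpace ℝ (Fin r) → ℝ)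
    (h : EuclideanSpace ℝ (Fin r ⊕ Fin q) → Fin t → ℝ) {n : ℕ} (x : Fin n → 𝒳)
    (ω : EuclideanSpace ℝ (Fin r ⊕ Fin q)) (lam : Fin t → ℝ) : Prop where
  score_eq : (n : ℝ)⁻¹ • (score f x (phiPart ω)).ofLp + jacJ h ω *ᵥ lam = 0
  multiplier_eq : jacK h ω *ᵥ lam = 0
  constraint_eq : h ω = 0

end Model

section Blocks

variable {r q t : ℕ} (B : Matrix (Fin r) (Fin r) ℝ) (J : Matrix (Fin r) (Fin t) ℝ)
  (K : Matrix (Fin q) (Fin t) ℝ)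

/-- The matrix `[[B, 0, -J], [0, 0, -K], [-Jᵀ, -Kᵀ, 0]]`. -/
def lagrangeMatrix : Matrix ((Fin r ⊕ Fin q) ⊕ Fin t) ((Fin r ⊕ Fin q) ⊕ Fin t) ℝ :=
  fromBlocks (fromBlocks B 0 0 0) (fromRows (-J) (-K)) (fromCols (-Jᵀ) (-Kᵀ)) 0

/-- The abbreviation `A = (Jᵀ B⁻¹ J)⁻¹`. -/
def matA : Matrix (Fin t) (Fin t) ℝ := (Jᵀ * B⁻¹ * J)⁻¹

def P22 : Matrix (Fin q) (Fin q) ℝ := (K * matA B J * Kᵀ)⁻¹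

def P11 : Matrix (Fin r) (Fin r) ℝ :=
  B⁻¹ - B⁻¹ * J * matA B J * Jᵀ * B⁻¹ +
    B⁻¹ * J * matA B J * Kᵀ * (K * matA B J * Kᵀ)⁻¹ * K * matA B J * Jᵀ * B⁻¹

def P12 : Matrix (Fin r) (Fin q) ℝ :=
  -(B⁻¹ * J * matA B J * Kᵀ * (K * matA B J * Kᵀ)⁻¹)

def P13 : Matrix (Fin r) (Fin t) ℝ :=
  -(B⁻¹ * J * matA B J) + B⁻¹ * J * matA B J * Kᵀ * (K * matA B J * Kᵀ)⁻¹ * K * matA B J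

def P23 : Matrix (Fin q) (Fin t) ℝ :=
  -((K * matA B J * Kᵀ)⁻¹ * K * matA B J)

def P33 : Matrix (Fin t) (Fin t) ℝ :=
  -matA B J + matA B J * Kᵀ * (K * matA B J * Kᵀ)⁻¹ * K * matA B J

def P21 : Matrix (Fin q) (Fin r) ℝ := (P12 B J K)ᵀ

def P31 : Matrix (Fin t) (Fin r) ℝ := (P13 B J K)ᵀ

def P32 : Matrix (Fin t) (Fin q) ℝ := (P23 B J K)ᵀ

/-- The matrix `(P_ij)` with `3 × 3` blocks. -/
def blockP : Matrix ((Fin r ⊕ Fin q) ⊕ Fin t) ((Fin r ⊕ Fin q) ⊕ Fin t) ℝ :=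
  fromBlocks (fromBlocks (P11 B J K) (P12 B J K) (P21 B J K) (P22 B J K))
    (fromRows (P13 B J K) (P23 B J K)) (fromCols (P31 B J K) (P32 B J K)) (P33 B J K)

/-- The asymptotic covariance `[[P11, P12, 0], [P21, P22, 0], [0, 0, -P33]]`. -/
def asympCov : Matrix ((Fin r ⊕ Fin q) ⊕ Fin t) ((Fin r ⊕ Fin q) ⊕ Fin t) ℝ :=
  fromBlocks (fromBlocks (P11 B J K) (P12 B J K) (P21 B J K) (P22 B J K)) 0 0 (-P33 B J K)

end Blocks

/-- The vector `(φ - φ₀, ψ - ψ₀, lam)` in `ℝ^{s+t}`. -/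
def errorVec {r q t : ℕ} (ω₀ ω : EuclideanSpace ℝ (Fin r ⊕ Fin q)) (lam : Fin t → ℝ) :
    EuclideanSpace ℝ ((Fin r ⊕ Fin q) ⊕ Fin t) :=
  WithLp.toLp 2 (Sum.elim (fun i => ω i - ω₀ i) lam)

/-- The sequence of estimators `(ω̂_n, λ̂_n)`, extended to all samples. The sequences `δ`, `ε`
decrease to zero, and `X n` is a good set for `(δ m, ε m)` when `N m ≤ n < N (m + 1)`. On `X n`
the pair solves the Lagrange equations, with `ω̂_n` at distance less than `δ m` from `ω₀`; off
`X n` it is given by the linear formula. For the finitely many `n < N 0` it is arbitrary. -/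
structure IsEstimatorSequence {𝒳 : Type*} [MeasurableSpace 𝒳] {r q t : ℕ}
    (P : Measure 𝒳) [IsProbabilityMeasure P] (f : 𝒳 → EuclideanSpace ℝ (Fin r) → ℝ)
    (h : EuclideanSpace ℝ (Fin r ⊕ Fin q) → Fin t → ℝ)
    (ω₀ : EuclideanSpace ℝ (Fin r ⊕ Fin q)) (α κ₁ : ℝ)
    (δ ε : ℕ → ℝ) (N : ℕ → ℕ) (X : (n : ℕ) → Set (Fin n → 𝒳))
    (ωHat : (n : ℕ) → (Fin n → 𝒳) → EuclideanSpace ℝ (Fin r ⊕ Fin q))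
    (lamHat : (n : ℕ) → (Fin n → 𝒳) → Fin t → ℝ) : Prop where
  delta_pos : ∀ m, 0 < δ m
  delta_anti : Antitone δ
  delta_lt : δ 0 < α
  delta_lim : Tendsto δ atTop (𝓝 0)
  eps_pos : ∀ m, 0 < ε m
  eps_anti : Antitone ε
  eps_lt : ε 0 < 1
  eps_lim : Tendsto ε atTop (𝓝 0)
  N_mono : StrictMono N
  good : ∀ m n, N m ≤ n → n < N (m + 1) →
    IsGoodSet P f (phiPart ω₀) α κ₁ (δ m) (ε m) (X n)
  aemeasurable_omega : ∀ n, AEMeasurable (ωHat n) (Measure.pi fun _ : Fin n => P)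
  aemeasurable_lam : ∀ n, AEMeasurable (lamHat n) (Measure.pi fun _ : Fin n => P)
  solves : ∀ m n, N m ≤ n → n < N (m + 1) → ∀ x ∈ X n,
    ‖ωHat n x - ω₀‖ < δ m ∧ SolvesLagrange f h x (ωHat n x) (lamHat n x)
  linear : ∀ n, N 0 ≤ n → ∀ x, x ∉ X n →
    (errorVec ω₀ (ωHat n x) (lamHat n x)).ofLp =
      blockP (fisherInfo P f (phiPart ω₀)) (jacJ h ω₀) (jacK h ω₀) *ᵥ
        Sum.elim (Sum.elim ((n : ℝ)⁻¹ • (score f x (phiPart ω₀)).ofLp) 0) 0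

end PartialID

end

/-!
The score of one observation is centred (differentiate `∫ f(y, φ) dν = 1` under the integral sign)
and has covariance `B`, so the averaged score `u` at the true value satisfies `√n u → N(0, B)`.
On a good sample, Taylor expansion at the true value turns the Lagrange equations into the linear
system with matrix `M = lagrangeMatrix B J K` and right-hand side `(u, 0, 0)`, for the error vector
`v = (ω̂ - ω₀, λ̂)`. The residual is of order `δ ‖v‖`, because every neglected term is a product of
two factors, one bounded by `δ` and the other by `‖v‖` (`SolvesLagrange.abs_residual_le`). Inverting
`M`, whose inverse is `(P_ij)` (`lagrangeMatrix_mul_blockP`), and absorbing the residual for small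
`δ`, one gets `v = P (u, 0, 0) + O(δ ‖u‖)`. On the remaining samples this holds without error by
the definition of the estimators.

Hence `√n v` is asymptotically linear in the score with coefficient matrix `C`, the first block
column of `P` (`firstCol`). Since `√n u` is bounded in `L¹`, the error term does not change the
limit of the characteristic functions, and the one-dimensional central limit theorem gives
the limit `N(0, C B Cᵀ)` (`tendstoInDistribution_of_asymptotically_linear`). The block relations
contained in `M P = 1` show that `C B Cᵀ` is the stated covariance (`asympCov_eq`), which is thereby
positive semidefinite.

The hypotheses provide partial derivatives only, so the Taylor expansions are
obtained by changing one coordinate at a time, starting at the centre of the ball; such a path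
never leaves the ball (`exists_sub_eq_sum_pd`).
-/

namespace PartialID

/-! ### Calculus with partial derivatives only -/

section Calculus

variable {ι : Type*} [Fintype ι] [DecidableEq ι]

omit [Fintype ι] in
lemma HasPD.hasDerivAt {g : EuclideanSpace ℝ ι → ℝ} {i : ι} {w : EuclideanSpace ℝ ι} {τ : ℝ}
    (hg : HasPD g i (w + τ • EuclideanSpace.single i 1)) :
    HasDerivAt (fun σ : ℝ => g (w + σ • EuclideanSpace.single i 1))
      (pd g i (w + τ • EuclideanSpace.single i 1)) τ := by
  have h1 := hg.hasLineDerivAt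
  unfold HasLineDerivAt at h1
  rw [← sub_self τ] at h1
  refine (h1.comp_sub_const τ τ).congr_of_eventuallyEq (Eventually.of_forall fun σ => ?_)
  simp only
  congr 1
  module

omit [DecidableEq ι] in
lemma dist_le_dist_of_forall_abs_sub_le {c v w : EuclideanSpace ℝ ι}
    (hw : ∀ j, |w j - c j| ≤ |v j - c j|) : dist w c ≤ dist v c := by
  rw [EuclideanSpace.dist_eq, EuclideanSpace.dist_eq]
  refine Real.sqrt_le_sqrt (Finset.sum_le_sum fun j _ => ?_)
  rw [Real.dist_eq, Real.dist_eq]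
  exact pow_le_pow_left₀ (abs_nonneg _) (hw j) 2

omit [DecidableEq ι] in
lemma abs_sub_apply_le (v c : EuclideanSpace ℝ ι) (i : ι) : |v i - c i| ≤ dist v c := by
  rw [dist_eq_norm]
  exact PiLp.norm_apply_le (v - c) i

/-- Mean value theorem for a function that merely has partial derivatives: changing the
coordinates of the centre one at a time never leaves the ball, so the increment from the centre
is a combination of partial derivatives at points of the ball. -/
lemma exists_sub_eq_sum_pd {G : EuclideanSpace ℝ ι → ℝ} {c v : EuclideanSpace ℝ ι}
    (hG : ∀ i, ∀ w ∈ Metric.closedBall c (dist v c), HasPD G i w) :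
    ∃ ξ : ι → EuclideanSpace ℝ ι, (∀ i, ξ i ∈ Metric.closedBall c (dist v c)) ∧
      G v - G c = ∑ i, pd G i (ξ i) * (v i - c i) := by
  have key : ∀ s : Finset ι, ∃ ξ : ι → EuclideanSpace ℝ ι,
      (∀ i, ξ i ∈ Metric.closedBall c (dist v c)) ∧
      G (WithLp.toLp 2 fun j => if j ∈ s then v j else c j) - G c =
        ∑ i ∈ s, pd G i (ξ i) * (v i - c i) := by
    intro s
    -- the coordinates in `s` have already been moved from `c` to `v`
    induction s using Finset.induction_on with
    | empty =>
      refine ⟨fun _ => c, fun _ => Metric.mem_closedBall_self dist_nonneg, ?_⟩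
      simp
    | insert a s ha ih =>
      obtain ⟨ξ, hξ, hs⟩ := ih
      set p : EuclideanSpace ℝ ι := WithLp.toLp 2 fun j => if j ∈ s then v j else c j with hp
      set d := v a - c a with hd
      have hpa : p a = c a := by simp [hp, ha]
      have hmem : ∀ τ ∈ Set.Icc (0 : ℝ) 1,
          p + (τ * d) • EuclideanSpace.single a (1 : ℝ) ∈ Metric.closedBall c (dist v c) := by
        intro τ hτ
        refine dist_le_dist_of_forall_abs_sub_le fun j => ?_
        by_cases hj : j = a
        · subst hj
          have : (p + (τ * d) • EuclideanSpace.single j (1 : ℝ)) j - c j = τ * d := by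
            simp [hpa]
          rw [this, abs_mul, abs_of_nonneg hτ.1]
          exact mul_le_of_le_one_left (abs_nonneg _) hτ.2
        · have : (p + (τ * d) • EuclideanSpace.single a (1 : ℝ)) j = p j := by
            simp [hj]
          rw [this]
          by_cases hjs : j ∈ s <;> simp [hp, hjs]
      have hder : ∀ τ ∈ Set.Icc (0 : ℝ) 1,
          HasDerivAt (fun σ : ℝ => G (p + (σ * d) • EuclideanSpace.single a (1 : ℝ)))
            (pd G a (p + (τ * d) • EuclideanSpace.single a (1 : ℝ)) * d) τ := by
        intro τ hτ
        have h1 := (hG a _ (hmem τ hτ)).hasDerivAt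
        have h2 : HasDerivAt (fun σ : ℝ => σ * d) d τ := by
          simpa using (hasDerivAt_id τ).mul_const d
        exact HasDerivAt.comp τ h1 h2
      obtain ⟨τ, hτ, hslope⟩ := exists_hasDerivAt_eq_slope
        (fun σ : ℝ => G (p + (σ * d) • EuclideanSpace.single a (1 : ℝ)))
        (fun τ => pd G a (p + (τ * d) • EuclideanSpace.single a (1 : ℝ)) * d) one_pos
        (fun τ hτ => (hder τ hτ).continuousAt.continuousWithinAt)
        (fun τ hτ => hder τ ⟨hτ.1.le, hτ.2.le⟩)
      have hend : (WithLp.toLp 2 fun j => if j ∈ insert a s then v j else c j :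
          EuclideanSpace ℝ ι) = p + (1 * d) • EuclideanSpace.single a (1 : ℝ) := by
        ext j
        by_cases hj : j = a
        · subst hj; simp [hp, ha, hd]
        · simp [hp, hj]
      refine ⟨Function.update ξ a (p + (τ * d) • EuclideanSpace.single a (1 : ℝ)), ?_, ?_⟩
      · intro i
        by_cases hi : i = a
        · subst hi; simpa using hmem τ ⟨hτ.1.le, hτ.2.le⟩
        · simpa [hi] using hξ i
      · rw [Finset.sum_insert ha, Function.update_self, hslope, hend]
        have : ∑ i ∈ s, pd G i (Function.update ξ a
            (p + (τ * d) • EuclideanSpace.single a (1 : ℝ)) i) * (v i - c i) =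
            ∑ i ∈ s, pd G i (ξ i) * (v i - c i) := by
          refine Finset.sum_congr rfl fun i hi => ?_
          rw [Function.update_of_ne (ne_of_mem_of_not_mem hi ha)]
        rw [this, ← hs]
        simp
  obtain ⟨ξ, hξ, h⟩ := key Finset.univ
  refine ⟨ξ, hξ, ?_⟩
  simpa using h

lemma abs_sub_le_of_abs_pd_le {G : EuclideanSpace ℝ ι → ℝ} {c v : EuclideanSpace ℝ ι} {L : ℝ}
    (hG : ∀ i, ∀ w ∈ Metric.closedBall c (dist v c), HasPD G i w)
    (hL : ∀ i, ∀ w ∈ Metric.closedBall c (dist v c), |pd G i w| ≤ L) :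
    |G v - G c| ≤ Fintype.card ι * L * dist v c := by
  obtain ⟨ξ, hξ, h⟩ := exists_sub_eq_sum_pd hG
  rw [h]
  calc |∑ i, pd G i (ξ i) * (v i - c i)| ≤ ∑ i, |pd G i (ξ i) * (v i - c i)| :=
        Finset.abs_sum_le_sum_abs _ _
    _ ≤ ∑ _i : ι, L * dist v c := by
        refine Finset.sum_le_sum fun i _ => ?_
        rw [abs_mul]
        exact mul_le_mul (hL i _ (hξ i)) (abs_sub_apply_le v c i) (abs_nonneg _)
          ((abs_nonneg _).trans (hL i _ (hξ i)))
    _ = Fintype.card ι * L * dist v c := by simp [mul_assoc]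

/-- First-order Taylor expansion at the centre of a ball on which the second partial derivatives
exist and are bounded by `L`. -/
lemma abs_sub_sub_sum_pd_le {G : EuclideanSpace ℝ ι → ℝ} {c v : EuclideanSpace ℝ ι} {L : ℝ}
    (hG : ∀ i, ∀ w ∈ Metric.closedBall c (dist v c), HasPD G i w)
    (hG2 : ∀ i j, ∀ w ∈ Metric.closedBall c (dist v c), HasPD (pd G i) j w)
    (hL : ∀ i j, ∀ w ∈ Metric.closedBall c (dist v c), |pd (pd G i) j w| ≤ L) :
    |G v - G c - ∑ i, pd G i c * (v i - c i)| ≤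
      Fintype.card ι * (Fintype.card ι * L) * dist v c ^ 2 := by
  obtain ⟨ξ, hξ, h⟩ := exists_sub_eq_sum_pd hG
  rw [h, ← Finset.sum_sub_distrib]
  calc |∑ i, (pd G i (ξ i) * (v i - c i) - pd G i c * (v i - c i))|
      ≤ ∑ i, |pd G i (ξ i) * (v i - c i) - pd G i c * (v i - c i)| :=
        Finset.abs_sum_le_sum_abs _ _
    _ ≤ ∑ _i : ι, (Fintype.card ι * L) * dist v c ^ 2 := by
        refine Finset.sum_le_sum fun i _ => ?_
        have hL0 : 0 ≤ L := (abs_nonneg _).trans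
          (hL i i c (Metric.mem_closedBall_self dist_nonneg))
        have hsub : Metric.closedBall c (dist (ξ i) c) ⊆ Metric.closedBall c (dist v c) :=
          Metric.closedBall_subset_closedBall (hξ i)
        have h1 := abs_sub_le_of_abs_pd_le (G := pd G i) (v := ξ i) (c := c)
          (fun j w hw => hG2 i j w (hsub hw)) (fun j w hw => hL i j w (hsub hw))
        have h2 : dist (ξ i) c ≤ dist v c := hξ i
        rw [← sub_mul, abs_mul, pow_two, ← mul_assoc]
        refine mul_le_mul (h1.trans ?_) (abs_sub_apply_le v c i) (abs_nonneg _) (by positivity)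
        gcongr
    _ = _ := by simp [mul_assoc]

omit [Fintype ι] in
lemma HasPD.sum {κ : Type*} {s : Finset κ} {g : κ → EuclideanSpace ℝ ι → ℝ} {i : ι}
    {w : EuclideanSpace ℝ ι} (hg : ∀ k ∈ s, HasPD (g k) i w) :
    HasPD (fun w' => ∑ k ∈ s, g k w') i w ∧
      pd (fun w' => ∑ k ∈ s, g k w') i w = ∑ k ∈ s, pd (g k) i w := by
  have h : HasLineDerivAt ℝ (fun w' => ∑ k ∈ s, g k w') (∑ k ∈ s, pd (g k) i w) w
      (EuclideanSpace.single i 1) := by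
    unfold HasLineDerivAt
    exact HasDerivAt.fun_sum fun k hk => (hg k hk).hasLineDerivAt
  exact ⟨h.lineDifferentiableAt, h.lineDeriv⟩

lemma HasPD.congr {g g' : EuclideanSpace ℝ ι → ℝ} {i : ι} {w : EuclideanSpace ℝ ι}
    (h : g =ᶠ[𝓝 w] g') (hg : HasPD g i w) : HasPD g' i w :=
  (h.lineDifferentiableAt_iff (𝕜 := ℝ)).1 hg

lemma pd_congr {g g' : EuclideanSpace ℝ ι → ℝ} {i : ι} {w : EuclideanSpace ℝ ι}
    (h : g =ᶠ[𝓝 w] g') : pd g i w = pd g' i w :=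
  h.lineDeriv_eq

end Calculus

section LogLik

variable {𝒳 : Type*} {r : ℕ}

/-- The existence requirement of `DensityConditions` for a single observation: the log-density
has partial derivatives up to the third order on the ball. -/
def HasThirdPD (f : 𝒳 → EuclideanSpace ℝ (Fin r) → ℝ) (φ₀ : EuclideanSpace ℝ (Fin r)) (α : ℝ)
    (y : 𝒳) : Prop :=
  ∀ φ ∈ Metric.closedBall φ₀ α,
    (∀ i, HasPD (fun φ' => Real.log (f y φ')) i φ) ∧
    (∀ i j, HasPD (pd (fun φ' => Real.log (f y φ')) i) j φ) ∧
    (∀ i j k, HasPD (pd (pd (fun φ' => Real.log (f y φ')) i) j) k φ)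

variable {f : 𝒳 → EuclideanSpace ℝ (Fin r) → ℝ} {φ₀ : EuclideanSpace ℝ (Fin r)} {α : ℝ}
  {n : ℕ} {x : Fin n → 𝒳}

lemma pd_logLik (hx : ∀ k, HasThirdPD f φ₀ α (x k)) (i : Fin r) {φ : EuclideanSpace ℝ (Fin r)}
    (hφ : φ ∈ Metric.closedBall φ₀ α) :
    pd (logLik f x) i φ = ∑ k, pd (fun φ' => Real.log (f (x k) φ')) i φ :=
  (HasPD.sum (fun k _ => ((hx k) φ hφ).1 i)).2

lemma pd_logLik_eventuallyEq (hx : ∀ k, HasThirdPD f φ₀ α (x k)) (i : Fin r)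
    {φ : EuclideanSpace ℝ (Fin r)} (hφ : φ ∈ Metric.ball φ₀ α) :
    (fun φ => ∑ k, pd (fun φ' => Real.log (f (x k) φ')) i φ) =ᶠ[𝓝 φ] pd (logLik f x) i := by
  filter_upwards [Metric.isOpen_ball.mem_nhds hφ] with ψ hψ
  exact (pd_logLik hx i (Metric.ball_subset_closedBall hψ)).symm

lemma hasPD_pd_logLik (hx : ∀ k, HasThirdPD f φ₀ α (x k)) (i j : Fin r)
    {φ : EuclideanSpace ℝ (Fin r)} (hφ : φ ∈ Metric.ball φ₀ α) :
    HasPD (pd (logLik f x) i) j φ ∧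
      pd (pd (logLik f x) i) j φ = ∑ k, pd (pd (fun φ' => Real.log (f (x k) φ')) i) j φ := by
  have h := HasPD.sum (s := Finset.univ) (i := j) (w := φ)
    (g := fun k => pd (fun φ' => Real.log (f (x k) φ')) i)
    (fun k _ => ((hx k) φ (Metric.ball_subset_closedBall hφ)).2.1 i j)
  have hE := pd_logLik_eventuallyEq hx i hφ
  exact ⟨h.1.congr hE, (pd_congr hE).symm.trans h.2⟩

lemma hasPD_pd_pd_logLik (hx : ∀ k, HasThirdPD f φ₀ α (x k)) (i j l : Fin r)
    {φ : EuclideanSpace ℝ (Fin r)} (hφ : φ ∈ Metric.ball φ₀ α) :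
    HasPD (pd (pd (logLik f x) i) j) l φ := by
  have h := HasPD.sum (s := Finset.univ) (i := l) (w := φ)
    (g := fun k => pd (pd (fun φ' => Real.log (f (x k) φ')) i) j)
    (fun k _ => ((hx k) φ (Metric.ball_subset_closedBall hφ)).2.2 i j l)
  refine h.1.congr ?_
  filter_upwards [Metric.isOpen_ball.mem_nhds hφ] with ψ hψ
  exact (hasPD_pd_logLik hx i j hψ).2.symm

end LogLik

/-! ### The block inverse and the asymptotic covariance -/

section BlockAlgebra

variable {r q t : ℕ} {B : Matrix (Fin r) (Fin r) ℝ} {J : Matrix (Fin r) (Fin t) ℝ}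
  {K : Matrix (Fin q) (Fin t) ℝ}

lemma mulVec_injective_of_rank_eq {m n : ℕ} {J : Matrix (Fin m) (Fin n) ℝ} (hJ : J.rank = n) :
    Function.Injective J.mulVec := by
  rw [Matrix.mulVec_injective_iff]
  rw [linearIndependent_iff_card_eq_finrank_span, Set.finrank,
    ← Matrix.rank_eq_finrank_span_cols, hJ]
  simp

lemma posDef_transpose_mul_inv_mul (hB : B.PosDef) (hJ : J.rank = t) :
    (Jᵀ * B⁻¹ * J).PosDef := by
  have := hB.inv.conjTranspose_mul_mul_same (mulVec_injective_of_rank_eq hJ)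
  simpa using this

lemma posDef_matA (hB : B.PosDef) (hJ : J.rank = t) : (matA B J).PosDef :=
  (posDef_transpose_mul_inv_mul hB hJ).inv

lemma posDef_mul_matA_mul (hB : B.PosDef) (hJ : J.rank = t) (hK : K.rank = q) :
    (K * matA B J * Kᵀ).PosDef := by
  have hK' : Kᵀ.rank = q := by rw [Matrix.rank_transpose, hK]
  have := (posDef_matA hB hJ).conjTranspose_mul_mul_same (mulVec_injective_of_rank_eq hK')
  simpa using this

lemma isSymm_of_posDef {n : ℕ} {B : Matrix (Fin n) (Fin n) ℝ} (hB : B.PosDef) : Bᵀ = B := by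
  simpa using hB.isHermitian.eq

lemma isUnit_det_of_posDef {n : ℕ} {B : Matrix (Fin n) (Fin n) ℝ} (hB : B.PosDef) :
    IsUnit B.det :=
  hB.det_pos.ne'.isUnit

/-- The first block column of `(P_ij)`. -/
noncomputable def firstCol (B : Matrix (Fin r) (Fin r) ℝ) (J : Matrix (Fin r) (Fin t) ℝ)
    (K : Matrix (Fin q) (Fin t) ℝ) : Matrix ((Fin r ⊕ Fin q) ⊕ Fin t) (Fin r) ℝ :=
  fromRows (fromRows (P11 B J K) (P21 B J K)) (P31 B J K)

lemma blockP_mulVec (u : Fin r → ℝ) :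
    blockP B J K *ᵥ Sum.elim (Sum.elim u 0) 0 = firstCol B J K *ᵥ u := by
  simp only [blockP, firstCol, fromBlocks_mulVec, fromRows_mulVec, fromCols_mulVec]
  ext ((i | i) | i) <;> simp

lemma P11_eq : P11 B J K = B⁻¹ - B⁻¹ * (J * (matA B J * (Jᵀ * B⁻¹))) +
    B⁻¹ * (J * (matA B J * (Kᵀ * (P22 B J K * (K * (matA B J * (Jᵀ * B⁻¹))))))) := by
  simp [P11, P22, Matrix.mul_assoc]

variable (hB : B.PosDef) (hJ : J.rank = t) (hK : K.rank = q)
include hB hJ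

lemma P21_eq : P21 B J K = -(P22 B J K * (K * (matA B J * (Jᵀ * B⁻¹)))) := by
  have hA := isSymm_of_posDef (posDef_matA hB hJ)
  have hBi := isSymm_of_posDef hB.inv
  have hS : (K * matA B J * Kᵀ)ᵀ = K * matA B J * Kᵀ := by
    simp [Matrix.transpose_mul, hA, Matrix.mul_assoc]
  simp only [P21, P12, P22, transpose_neg, transpose_mul, transpose_nonsing_inv, hA, hBi,
    transpose_transpose, Matrix.mul_assoc]

lemma P31_eq : P31 B J K = -(matA B J * (Jᵀ * B⁻¹)) +
    matA B J * (Kᵀ * (P22 B J K * (K * (matA B J * (Jᵀ * B⁻¹))))) := by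
  have hA := isSymm_of_posDef (posDef_matA hB hJ)
  have hB' := isSymm_of_posDef hB
  simp [P31, P13, P22, transpose_mul, transpose_nonsing_inv, hA, hB', Matrix.mul_assoc]

lemma P32_eq : P32 B J K = -(matA B J * (Kᵀ * P22 B J K)) := by
  have hA := isSymm_of_posDef (posDef_matA hB hJ)
  simp [P32, P23, P22, transpose_mul, transpose_nonsing_inv, hA, Matrix.mul_assoc]

/-- The block identities that express `lagrangeMatrix * blockP = 1`. -/
structure BlockRelations (B : Matrix (Fin r) (Fin r) ℝ) (J : Matrix (Fin r) (Fin t) ℝ)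
    (K : Matrix (Fin q) (Fin t) ℝ) : Prop where
  B_P11 : B * P11 B J K = 1 + J * P31 B J K
  B_P12 : B * P12 B J K = J * P32 B J K
  B_P13 : B * P13 B J K = J * P33 B J K
  K_P31 : K * P31 B J K = 0
  K_P32 : K * P32 B J K = -1
  K_P33 : K * P33 B J K = 0
  Jt_P11 : Jᵀ * P11 B J K = -(Kᵀ * P21 B J K)
  Jt_P12 : Jᵀ * P12 B J K = -(Kᵀ * P22 B J K)
  Jt_P13 : Jᵀ * P13 B J K = -1 - Kᵀ * P23 B J K

include hK

lemma blockRelations : BlockRelations B J K := by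
  have hBu := isUnit_det_of_posDef hB
  have hAu := isUnit_det_of_posDef (posDef_transpose_mul_inv_mul hB hJ)
  have hSu := isUnit_det_of_posDef (posDef_mul_matA_mul hB hJ hK)
  have b0 : B * B⁻¹ = 1 := mul_nonsing_inv _ hBu
  have b1 : ∀ {m : ℕ} (Y : Matrix (Fin r) (Fin m) ℝ), B * (B⁻¹ * Y) = Y := fun Y =>
    mul_nonsing_inv_cancel_left _ _ hBu
  have a0 : Jᵀ * (B⁻¹ * (J * matA B J)) = 1 := by
    simpa [matA, Matrix.mul_assoc] using mul_nonsing_inv _ hAu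
  have a1 : ∀ {m : ℕ} (Y : Matrix (Fin t) (Fin m) ℝ),
      Jᵀ * (B⁻¹ * (J * (matA B J * Y))) = Y := fun Y => by
    have := congrArg (· * Y) a0
    simpa [Matrix.mul_assoc] using this
  have s0 : K * (matA B J * (Kᵀ * P22 B J K)) = 1 := by
    simpa [P22, Matrix.mul_assoc] using mul_nonsing_inv _ hSu
  have s1 : ∀ {m : ℕ} (Y : Matrix (Fin q) (Fin m) ℝ),
      K * (matA B J * (Kᵀ * (P22 B J K * Y))) = Y := fun Y => by
    have := congrArg (· * Y) s0
    simpa [Matrix.mul_assoc] using this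
  have e12 : P12 B J K = -(B⁻¹ * (J * (matA B J * (Kᵀ * P22 B J K)))) := by
    simp [P12, P22, Matrix.mul_assoc]
  have e13 : P13 B J K = -(B⁻¹ * (J * matA B J)) +
      B⁻¹ * (J * (matA B J * (Kᵀ * (P22 B J K * (K * matA B J))))) := by
    simp [P13, P22, Matrix.mul_assoc]
  have e23 : P23 B J K = -(P22 B J K * (K * matA B J)) := by
    simp [P23, P22, Matrix.mul_assoc]
  have e33 : P33 B J K = -matA B J +
      matA B J * (Kᵀ * (P22 B J K * (K * matA B J))) := by
    simp [P33, P22, Matrix.mul_assoc]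
  constructor <;>
    simp only [P11_eq, P21_eq hB hJ, P31_eq hB hJ, P32_eq hB hJ, e12, e13, e23, e33,
      Matrix.mul_add, Matrix.mul_sub, Matrix.mul_neg, b0, b1, a0, a1, s0, s1] <;>
    abel

lemma lagrangeMatrix_mul_blockP : lagrangeMatrix B J K * blockP B J K = 1 := by
  have R := blockRelations hB hJ hK
  rw [lagrangeMatrix, blockP, fromBlocks_multiply, fromBlocks_multiply, fromRows_mul_fromCols,
    fromBlocks_mul_fromRows, fromCols_mul_fromRows, fromCols_mul_fromBlocks, fromRows_mul,
    fromBlocks_add]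
  simp only [Matrix.neg_mul, Matrix.zero_mul, R.B_P11, R.B_P12, R.B_P13, R.K_P31, R.K_P32,
    R.K_P33, R.Jt_P11, R.Jt_P12, R.Jt_P13]
  have hrows : (fromRows (J * P33 B J K) 0 : Matrix (Fin r ⊕ Fin q) (Fin t) ℝ) +
      fromRows (-(J * P33 B J K)) 0 = 0 := by
    ext (i | i) j <;> simp
  simp [hrows]

lemma asympCov_eq : asympCov B J K = firstCol B J K * B * (firstCol B J K)ᵀ := by
  have R := blockRelations hB hJ hK
  have hA := isSymm_of_posDef (posDef_matA hB hJ)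
  have hB' := isSymm_of_posDef hB
  have e11 : (P11 B J K)ᵀ = P11 B J K := by
    simp [P11, transpose_mul, transpose_nonsing_inv, hA, hB', Matrix.mul_assoc]
  have e22 : (P22 B J K)ᵀ = P22 B J K := by
    simp [P22, transpose_mul, transpose_nonsing_inv, hA, Matrix.mul_assoc]
  have hP11J : P11 B J K * J = -(P12 B J K * K) := by
    simpa [transpose_mul, e11, P21] using congrArg transpose R.Jt_P11
  have hP21J : P21 B J K * J = -(P22 B J K * K) := by
    simpa [transpose_mul, e22, P21] using congrArg transpose R.Jt_P12
  have hP31J : P31 B J K * J = -1 - P32 B J K * K := by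
    simpa [transpose_mul, P31, P32] using congrArg transpose R.Jt_P13
  have hT : (firstCol B J K)ᵀ =
      fromCols (fromCols (P11 B J K) (P12 B J K)) (P13 B J K) := by
    simp [firstCol, transpose_fromRows, e11, P21, P31]
  rw [hT, Matrix.mul_assoc, mul_fromCols B, mul_fromCols B, R.B_P11, R.B_P12, R.B_P13, firstCol,
    fromRows_mul_fromCols, fromRows_mul_fromCols, fromRows_mul, mul_fromCols, asympCov]
  simp only [Matrix.mul_add, Matrix.mul_one, ← Matrix.mul_assoc, hP11J, hP21J, hP31J,
    Matrix.neg_mul, Matrix.sub_mul, Matrix.one_mul]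
  simp only [Matrix.mul_assoc, R.K_P31, R.K_P32, R.K_P33]
  simp

lemma posSemidef_asympCov : (asympCov B J K).PosSemidef := by
  rw [asympCov_eq hB hJ hK]
  simpa using hB.posSemidef.mul_mul_conjTranspose_same (firstCol B J K)

end BlockAlgebra

/-! ### Central limit theorem for asymptotically linear statistics -/

section CentralLimit

variable {𝒳 : Type*} [MeasurableSpace 𝒳] {P : Measure 𝒳} [IsProbabilityMeasure P]

lemma norm_exp_mul_I_sub_exp_mul_I_le (a b : ℝ) :
    ‖Complex.exp (a * Complex.I) - Complex.exp (b * Complex.I)‖ ≤ |a - b| := by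
  have h : Complex.exp (a * Complex.I) - Complex.exp (b * Complex.I) =
      Complex.exp (Complex.I * b) * (Complex.exp (Complex.I * ((a - b : ℝ) : ℂ)) - 1) := by
    rw [mul_sub, ← Complex.exp_add, mul_one]
    push_cast
    ring_nf
  rw [h, norm_mul, Complex.norm_exp_I_mul_ofReal, one_mul]
  exact Real.norm_exp_I_mul_ofReal_sub_one_le

lemma integral_exp_mul_sum_pi {Y : 𝒳 → ℝ} (hY : AEMeasurable Y P) (n : ℕ) (c : ℝ) :
    ∫ x : Fin n → 𝒳, Complex.exp ((c * ∑ k, Y (x k) : ℝ) * Complex.I)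
      ∂(Measure.pi fun _ => P) = charFun (P.map Y) c ^ n := by
  have h : ∀ x : Fin n → 𝒳, Complex.exp ((c * ∑ k, Y (x k) : ℝ) * Complex.I) =
      ∏ k, Complex.exp (c * Y (x k) * Complex.I) := by
    intro x
    rw [← Complex.exp_sum]
    push_cast
    rw [Finset.mul_sum, Finset.sum_mul]
  simp_rw [h]
  rw [integral_fintype_prod_eq_prod (f := fun (_ : Fin n) y => Complex.exp (c * Y y * Complex.I)),
    charFun_apply_real, integral_map hY (by fun_prop)]
  simp

lemma tendsto_charFun_inv_sqrt_pow {Y : 𝒳 → ℝ} (hY : MemLp Y 2 P) (h0 : ∫ y, Y y ∂P = 0) :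
    Tendsto (fun n : ℕ => charFun (P.map Y) (√(n : ℝ))⁻¹ ^ n) atTop
      (𝓝 (Complex.exp (-(∫ y, Y y ^ 2 ∂P : ℝ) / 2))) := by
  have hYm : AEMeasurable Y P := hY.aestronglyMeasurable.aemeasurable
  have hv0 : 0 ≤ ∫ y, Y y ^ 2 ∂P := integral_nonneg fun _ => sq_nonneg _
  rcases hv0.eq_or_lt' with hv | hv
  · have hz : Y =ᵐ[P] fun _ => 0 := by
      have h1 := (integral_eq_zero_iff_of_nonneg (fun _ => sq_nonneg _) hY.integrable_sq).1 hv
      filter_upwards [h1] with y hy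
      simpa using hy
    rw [Measure.map_congr hz, hv]
    simp
  · -- the limit theorem for unit variance is applied to `Y / σ` at the point `σ`
    set σ := √(∫ y, Y y ^ 2 ∂P) with hσ
    have hσ0 : σ ≠ 0 := (Real.sqrt_pos.2 hv).ne'
    have hσ2 : σ ^ 2 = ∫ y, Y y ^ 2 ∂P := Real.sq_sqrt hv0
    have key := tendsto_charFun_inv_sqrt_mul_pow (P := P) (X := fun y => Y y / σ)
      (hYm.div_const σ) (by rw [integral_div, h0, zero_div])
      (by
        simp only [Pi.pow_apply, div_pow]
        rw [integral_div, ← hσ2, div_self (pow_ne_zero 2 hσ0)]) σ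
    have hl : Complex.exp (-(σ : ℂ) ^ 2 / 2) =
        Complex.exp (-(∫ y, Y y ^ 2 ∂P : ℝ) / 2) := by
      rw [← hσ2]; push_cast; rfl
    rw [hl] at key
    refine key.congr fun n => ?_
    congr 1
    rw [charFun_apply_real, charFun_apply_real, integral_map (hYm.div_const σ) (by fun_prop),
      integral_map hYm (by fun_prop)]
    refine integral_congr_ae (Eventually.of_forall fun y => ?_)
    have : (σ : ℂ) ≠ 0 := by exact_mod_cast hσ0
    simp only
    congr 1
    push_cast
    field_simp

lemma memLp_comp_eval_pi {Y : 𝒳 → ℝ} (hY : MemLp Y 2 P) (n : ℕ) (k : Fin n) :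
    MemLp (fun x : Fin n → 𝒳 => Y (x k)) 2 (Measure.pi fun _ => P) :=
  hY.comp_measurePreserving (measurePreserving_eval (fun _ : Fin n => P) k)

lemma memLp_mul_sum_pi {Y : 𝒳 → ℝ} (hY : MemLp Y 2 P) (n : ℕ) (c : ℝ) :
    MemLp (fun x : Fin n → 𝒳 => c * ∑ k, Y (x k)) 2 (Measure.pi fun _ => P) :=
  (memLp_finsetSum _ fun k _ => memLp_comp_eval_pi hY n k).const_mul c

/-- The normalized sums of a centred square-integrable function are bounded in `L¹`. -/
lemma integral_abs_inv_sqrt_mul_sum_le {Y : 𝒳 → ℝ} (hY : MemLp Y 2 P) (h0 : ∫ y, Y y ∂P = 0)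
    (n : ℕ) :
    ∫ x : Fin n → 𝒳, |(√(n : ℝ))⁻¹ * ∑ k, Y (x k)| ∂(Measure.pi fun _ => P) ≤
      1 + ∫ y, Y y ^ 2 ∂P := by
  have hYi : Integrable Y P := hY.integrable one_le_two
  have hW := memLp_mul_sum_pi hY n (√(n : ℝ))⁻¹
  have hmean : ∫ x : Fin n → 𝒳, ∑ k, Y (x k) ∂(Measure.pi fun _ => P) = 0 := by
    rw [integral_finsetSum _ fun k _ => (memLp_comp_eval_pi hY n k).integrable one_le_two]
    refine Finset.sum_eq_zero fun k _ => ?_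
    rw [integral_comp_eval (μ := fun _ : Fin n => P) (i := k) hY.aestronglyMeasurable, h0]
  have hsq : ∫ x : Fin n → 𝒳, (∑ k, Y (x k)) ^ 2 ∂(Measure.pi fun _ => P) =
      n * ∫ y, Y y ^ 2 ∂P := by
    have h1 := variance_sum_pi (μ := fun _ : Fin n => P) (X := fun _ => Y) fun _ => hY
    have hfun : (∑ k : Fin n, fun ω : Fin n → 𝒳 => Y (ω k)) = fun ω => ∑ k, Y (ω k) := by
      ext ω; simp
    rw [hfun, variance_of_integral_eq_zero _ hmean,
      variance_of_integral_eq_zero hY.aestronglyMeasurable.aemeasurable h0] at h1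
    · simpa using h1
    · exact (memLp_finsetSum _ fun k _ =>
        memLp_comp_eval_pi hY n k).aestronglyMeasurable.aemeasurable
  calc ∫ x : Fin n → 𝒳, |(√(n : ℝ))⁻¹ * ∑ k, Y (x k)| ∂(Measure.pi fun _ => P)
      ≤ ∫ x : Fin n → 𝒳, (1 + ((√(n : ℝ))⁻¹ * ∑ k, Y (x k)) ^ 2) ∂(Measure.pi fun _ => P) := by
        refine integral_mono (hW.integrable one_le_two).abs
          ((integrable_const 1).add hW.integrable_sq) fun x => ?_
        -- `|w| ≤ 1 + w ^ 2`
        simp only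
        rw [← sq_abs]
        nlinarith [sq_nonneg (|(√(n : ℝ))⁻¹ * ∑ k, Y (x k)| - 1),
          abs_nonneg ((√(n : ℝ))⁻¹ * ∑ k, Y (x k))]
    _ = 1 + (n : ℝ)⁻¹ * (n * ∫ y, Y y ^ 2 ∂P) := by
        rw [integral_add (integrable_const 1) hW.integrable_sq]
        simp_rw [mul_pow]
        rw [integral_const_mul, hsq, inv_pow, Real.sq_sqrt n.cast_nonneg]
        simp
    _ ≤ 1 + ∫ y, Y y ^ 2 ∂P := by
        have hv0 : 0 ≤ ∫ y, Y y ^ 2 ∂P := integral_nonneg fun _ => sq_nonneg _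
        rcases eq_or_ne n 0 with rfl | hn
        · simpa using hv0
        · rw [inv_mul_cancel_left₀ (Nat.cast_ne_zero.2 hn)]

/-- **Multivariate central limit theorem** for statistics that are asymptotically linear in a centred
square-integrable function `s` of the observations. The statistic `T n` may differ from the linear
one by an arbitrarily small multiple of the normalized sums, which are bounded in `L¹`; so the
characteristic functions have the same limit, which the one-dimensional limit theorem gives. -/
theorem tendstoInDistribution_of_asymptotically_linear {m : ℕ} {κ : Type*} [Fintype κ]
    [DecidableEq κ] {s : 𝒳 → Fin m → ℝ} (hs : ∀ i, MemLp (fun y => s y i) 2 P)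
    (h0 : ∀ i, ∫ y, s y i ∂P = 0) {B : Matrix (Fin m) (Fin m) ℝ}
    (hB : ∀ i j, B i j = ∫ y, s y i * s y j ∂P) {C : Matrix κ (Fin m) ℝ}
    (hC : (C * B * Cᵀ).PosSemidef) {T : (n : ℕ) → (Fin n → 𝒳) → EuclideanSpace ℝ κ}
    (hT : ∀ n, AEMeasurable (T n) (Measure.pi fun _ : Fin n => P))
    (hlin : ∀ η > 0, ∀ᶠ n : ℕ in atTop, ∀ᵐ x ∂(Measure.pi fun _ : Fin n => P),
      ‖T n x - WithLp.toLp 2 (C *ᵥ fun i => (√(n : ℝ))⁻¹ * ∑ k, s (x k) i)‖ ≤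
        η * ∑ i, |(√(n : ℝ))⁻¹ * ∑ k, s (x k) i|) :
    TendstoInDistribution T atTop (id : EuclideanSpace ℝ κ → _)
      (fun n : ℕ => Measure.pi fun _ : Fin n => P) (multivariateGaussian 0 (C * B * Cᵀ)) where
  forall_aemeasurable := hT
  tendsto := by
    refine ProbabilityMeasure.tendsto_iff_tendsto_charFun.2 fun z => ?_
    simp only [ProbabilityMeasure.coe_mk, Measure.map_id]
    rw [charFun_multivariateGaussian hC]
    -- testing against `z` reduces to the scalar summand `Y`, whose variance is `zᵀ C B Cᵀ z`
    set a : Fin m → ℝ := Cᵀ *ᵥ z.ofLp with ha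
    set Y : 𝒳 → ℝ := fun y => ∑ i, a i * s y i with hYdef
    have hY : MemLp Y 2 P := memLp_finsetSum _ fun i _ => (hs i).const_mul (a i)
    have hYm : AEMeasurable Y P := hY.aestronglyMeasurable.aemeasurable
    have hY0 : ∫ y, Y y ∂P = 0 := by
      rw [hYdef, integral_finsetSum _ fun i _ => ((hs i).integrable one_le_two).const_mul (a i)]
      simp [integral_const_mul, h0]
    have hY2 : ∫ y, Y y ^ 2 ∂P = z.ofLp ⬝ᵥ (C * B * Cᵀ) *ᵥ z.ofLp := by
      have h1 : z.ofLp ⬝ᵥ (C * B * Cᵀ) *ᵥ z.ofLp = a ⬝ᵥ B *ᵥ a := by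
        rw [ha, ← mulVec_mulVec, ← mulVec_mulVec, dotProduct_mulVec, ← mulVec_transpose]
      have h2 : ∀ y, Y y ^ 2 = ∑ i, ∑ j, a i * a j * (s y i * s y j) := by
        intro y
        rw [hYdef, pow_two, Finset.sum_mul_sum]
        refine Finset.sum_congr rfl fun i _ => Finset.sum_congr rfl fun j _ => by ring
      have hint : ∀ i j, Integrable (fun y => a i * a j * (s y i * s y j)) P := fun i j =>
        ((hs i).integrable_mul (hs j)).const_mul _
      simp_rw [h2]
      rw [integral_finsetSum _ fun i _ => integrable_finsetSum _ fun j _ => hint i j, h1,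
        dotProduct]
      refine Finset.sum_congr rfl fun i _ => ?_
      rw [integral_finsetSum _ fun j _ => hint i j, mulVec, dotProduct, Finset.mul_sum]
      refine Finset.sum_congr rfl fun j _ => ?_
      rw [integral_const_mul, hB]
      ring
    have hlim := tendsto_charFun_inv_sqrt_pow hY hY0
    have htarget : Complex.exp ((inner ℝ z (0 : EuclideanSpace ℝ κ) : ℝ) * Complex.I -
        (z.ofLp ⬝ᵥ (C * B * Cᵀ) *ᵥ z.ofLp : ℝ) / 2) =
        Complex.exp (-(∫ y, Y y ^ 2 ∂P : ℝ) / 2) := by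
      rw [hY2]; simp [neg_div]
    have hinner : ∀ (n : ℕ) (x : Fin n → 𝒳),
        inner ℝ (WithLp.toLp 2 (C *ᵥ fun i => (√(n : ℝ))⁻¹ * ∑ k, s (x k) i) :
          EuclideanSpace ℝ κ) z = (√(n : ℝ))⁻¹ * ∑ k, Y (x k) := by
      intro n x
      have h1 : inner ℝ (WithLp.toLp 2 (C *ᵥ fun i => (√(n : ℝ))⁻¹ * ∑ k, s (x k) i) :
          EuclideanSpace ℝ κ) z =
          z.ofLp ⬝ᵥ C *ᵥ fun i => (√(n : ℝ))⁻¹ * ∑ k, s (x k) i := by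
        simp [EuclideanSpace.inner_eq_star_dotProduct]
      rw [h1, dotProduct_mulVec, ← mulVec_transpose, ← ha, dotProduct, hYdef,
        Finset.sum_comm, Finset.mul_sum]
      refine Finset.sum_congr rfl fun i _ => ?_
      rw [← Finset.mul_sum]
      ring
    erw [htarget]
    refine tendsto_of_tendsto_of_dist hlim ?_
    rw [Metric.tendsto_atTop]
    intro e he
    set D : ℝ := ∑ i, (1 + ∫ y, s y i ^ 2 ∂P) with hD
    have hD0 : 0 ≤ D := Finset.sum_nonneg fun i _ =>
      add_nonneg zero_le_one (integral_nonneg fun _ => sq_nonneg _)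
    -- `D` bounds the `L¹` norm of the normalized sums, so the characteristic functions at `z`
    -- differ by at most `‖z‖ * η * D`
    have hη : 0 < e / (2 * ((‖z‖ + 1) * (D + 1))) := by positivity
    obtain ⟨n₀, hn₀⟩ := eventually_atTop.1 (hlin _ hη)
    refine ⟨n₀, fun n hn => ?_⟩
    set η := e / (2 * ((‖z‖ + 1) * (D + 1))) with hηdef
    rw [Real.dist_eq, sub_zero, abs_of_nonneg dist_nonneg, dist_comm, dist_eq_norm,
      ← integral_exp_mul_sum_pi hYm, charFun_apply, integral_map (hT n) (by fun_prop),
      ← integral_sub]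
    · have hWi : ∀ i, Integrable (fun x : Fin n → 𝒳 => |(√(n : ℝ))⁻¹ * ∑ k, s (x k) i|)
          (Measure.pi fun _ => P) := fun i =>
        ((memLp_mul_sum_pi (hs i) n _).integrable one_le_two).abs
      calc _ ≤ ∫ x : Fin n → 𝒳, ‖z‖ * (η * ∑ i, |(√(n : ℝ))⁻¹ * ∑ k, s (x k) i|)
            ∂(Measure.pi fun _ => P) := by
            refine norm_integral_le_of_norm_le
              (((integrable_finsetSum _ fun i _ => hWi i).const_mul η).const_mul ‖z‖) ?_
            filter_upwards [hn₀ n hn] with x hx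
            refine (norm_exp_mul_I_sub_exp_mul_I_le _ _).trans ?_
            rw [← hinner, ← inner_sub_left, mul_comm ‖z‖]
            exact (abs_real_inner_le_norm _ _).trans
              (mul_le_mul_of_nonneg_right hx (norm_nonneg z))
        _ = ‖z‖ * (η * ∑ i, ∫ x : Fin n → 𝒳, |(√(n : ℝ))⁻¹ * ∑ k, s (x k) i|
            ∂(Measure.pi fun _ => P)) := by
            rw [integral_const_mul, integral_const_mul, integral_finsetSum _ fun i _ => hWi i]
        _ ≤ (‖z‖ + 1) * (η * (D + 1)) := by
            have : ∑ i, ∫ x : Fin n → 𝒳, |(√(n : ℝ))⁻¹ * ∑ k, s (x k) i|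
                ∂(Measure.pi fun _ => P) ≤ D + 1 :=
              (Finset.sum_le_sum fun i _ =>
                integral_abs_inv_sqrt_mul_sum_le (hs i) (h0 i) n).trans (by linarith)
            gcongr
            linarith
        _ = e / 2 := by
            rw [hηdef]
            have h1 : ‖z‖ + 1 ≠ 0 := by positivity
            have h2 : D + 1 ≠ 0 := by positivity
            field_simp
        _ < e := half_lt_self he
    · refine Integrable.of_bound (C := 1) ?_ (Eventually.of_forall fun x => ?_)
      · exact (Complex.measurable_exp.comp_aemeasurable
          (by have := hT n; fun_prop)).aestronglyMeasurable
      · exact (Complex.norm_exp_ofReal_mul_I _).le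
    · refine Integrable.of_bound (C := 1) ?_ (Eventually.of_forall fun x => ?_)
      · have := (memLp_mul_sum_pi hY n (√(n : ℝ))⁻¹).aestronglyMeasurable.aemeasurable
        exact (Complex.measurable_exp.comp_aemeasurable
          ((Complex.measurable_ofReal.comp_aemeasurable this).mul_const _)).aestronglyMeasurable
      · exact (Complex.norm_exp_ofReal_mul_I _).le

end CentralLimit

/-! ### The score of one observation is centred -/

section Score

variable {𝒳 : Type*} [MeasurableSpace 𝒳] {r : ℕ} {ν P : Measure 𝒳}
  {f : 𝒳 → EuclideanSpace ℝ (Fin r) → ℝ} {φ₀ : EuclideanSpace ℝ (Fin r)} {α κ₁ : ℝ}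

lemma mem_ball_add_smul_single {i : Fin r} {τ : ℝ} (hτ : |τ| < α) :
    φ₀ + τ • EuclideanSpace.single i (1 : ℝ) ∈ Metric.ball φ₀ α := by
  simpa [norm_smul] using hτ

/-- Where a density is positive on the ball, its partial derivatives are recovered from those of
its logarithm. -/
lemma HasPD.of_log {g : EuclideanSpace ℝ (Fin r) → ℝ} {i : Fin r} {φ : EuclideanSpace ℝ (Fin r)}
    (hφ : φ ∈ Metric.ball φ₀ α) (hg : ∀ φ ∈ Metric.ball φ₀ α, 0 < g φ)
    (h : HasPD (fun φ' => Real.log (g φ')) i φ) :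
    HasPD g i φ ∧ pd g i φ = g φ * pd (fun φ' => Real.log (g φ')) i φ := by
  have h1 : HasLineDerivAt ℝ (fun φ' => Real.exp (Real.log (g φ')))
      (g φ * pd (fun φ' => Real.log (g φ')) i φ) φ (EuclideanSpace.single i 1) := by
    have h2 := h.hasLineDerivAt
    unfold HasLineDerivAt at h2 ⊢
    have h3 := h2.exp
    simp only [zero_smul, add_zero, Real.exp_log (hg φ hφ)] at h3
    exact h3
  have h4 : (fun φ' => Real.exp (Real.log (g φ'))) =ᶠ[𝓝 φ] g := by
    filter_upwards [Metric.isOpen_ball.mem_nhds hφ] with ψ hψ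
    exact Real.exp_log (hg ψ hψ)
  have h5 := (h4.hasLineDerivAt_iff (𝕜 := ℝ)).1 h1
  exact ⟨h5.lineDifferentiableAt, h5.lineDeriv⟩

/-- The score of one observation is centred: differentiate `∫ f(y, φ) dν = 1` under the
integral sign. -/
lemma DensityConditions.integral_score_eq_zero (hα : 0 < α)
    (hf : DensityConditions ν P f φ₀ α κ₁) (i : Fin r) :
    ∫ y, pd (fun φ' => Real.log (f y φ')) i φ₀ ∂P = 0 := by
  have hφ₀ : φ₀ ∈ Metric.closedBall φ₀ α := Metric.mem_closedBall_self hα.le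
  have hm₀ : Measurable fun y => ENNReal.ofReal (f y φ₀) :=
    ENNReal.measurable_ofReal.comp (hf.measurable φ₀ hφ₀)
  have haeP : ∀ {p : 𝒳 → Prop}, (∀ᵐ y ∂P, p y) → ∀ᵐ y ∂ν, 0 < f y φ₀ → p y := by
    intro p hp
    rw [hf.law, ae_withDensity_iff hm₀] at hp
    filter_upwards [hp] with y hy h0
    exact hy (by simpa using h0)
  obtain ⟨F₁, F₂, hF₁, -, hdom⟩ := hf.dominated
  set e : EuclideanSpace ℝ (Fin r) := EuclideanSpace.single i 1 with he
  have hfacts : ∀ᵐ y ∂ν, pd (f y) i φ₀ = f y φ₀ * pd (fun φ' => Real.log (f y φ')) i φ₀ ∧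
      ∀ τ ∈ Metric.ball (0 : ℝ) α, |pd (f y) i (φ₀ + τ • e)| ≤ |F₁ y| ∧
        HasDerivAt (fun σ : ℝ => f y (φ₀ + σ • e)) (pd (f y) i (φ₀ + τ • e)) τ := by
    filter_upwards [hf.support, haeP hf.exists_deriv, haeP hdom] with y hsupp hex hd
    by_cases h0 : 0 < f y φ₀
    · have hpos : ∀ φ ∈ Metric.ball φ₀ α, 0 < f y φ := fun φ hφ =>
        (hsupp φ (Metric.ball_subset_closedBall hφ)).2 h0
      refine ⟨(HasPD.of_log (Metric.mem_ball_self hα) hpos ((hex h0 φ₀ hφ₀).1 i)).2,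
        fun τ hτ => ?_⟩
      have hmem : φ₀ + τ • e ∈ Metric.ball φ₀ α :=
        mem_ball_add_smul_single (by simpa using hτ)
      have hmem' := Metric.ball_subset_closedBall hmem
      exact ⟨((hd h0 _ hmem').1 i).trans (le_abs_self _),
        (HasPD.of_log hmem hpos ((hex h0 _ hmem').1 i)).1.hasDerivAt⟩
    · -- off the common support the density vanishes identically on the ball
      have hzero : ∀ φ ∈ Metric.ball φ₀ α, f y φ = 0 := fun φ hφ => by
        have hφ' := Metric.ball_subset_closedBall hφ
        exact le_antisymm (not_lt.1 fun h => h0 ((hsupp φ hφ').1 h)) (hf.nonneg φ hφ' y)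
      have hz : ∀ φ ∈ Metric.ball φ₀ α, HasPD (f y) i φ ∧ pd (f y) i φ = 0 := by
        intro φ hφ
        have hE : (fun _ => (0 : ℝ)) =ᶠ[𝓝 φ] f y := by
          filter_upwards [Metric.isOpen_ball.mem_nhds hφ] with ψ hψ
          exact (hzero ψ hψ).symm
        have h1 : HasLineDerivAt ℝ (fun _ : EuclideanSpace ℝ (Fin r) => (0 : ℝ)) 0 φ
            (EuclideanSpace.single i 1) := by
          unfold HasLineDerivAt
          exact hasDerivAt_const _ _
        have h2 := (hE.hasLineDerivAt_iff (𝕜 := ℝ)).1 h1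
        exact ⟨h2.lineDifferentiableAt, h2.lineDeriv⟩
      refine ⟨?_, fun τ hτ => ?_⟩
      · rw [(hz φ₀ (Metric.mem_ball_self hα)).2, hzero φ₀ (Metric.mem_ball_self hα), zero_mul]
      have hmem : φ₀ + τ • e ∈ Metric.ball φ₀ α :=
        mem_ball_add_smul_single (by simpa using hτ)
      refine ⟨?_, (hz _ hmem).1.hasDerivAt⟩
      rw [(hz _ hmem).2, abs_zero]
      exact abs_nonneg _
  have hint : ∀ φ ∈ Metric.closedBall φ₀ α, ∫ y, f y φ ∂ν = 1 := by
    intro φ hφ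
    rw [integral_eq_lintegral_of_nonneg_ae (Eventually.of_forall (hf.nonneg φ hφ))
      (hf.measurable φ hφ).aestronglyMeasurable, hf.lintegral_eq_one φ hφ, ENNReal.toReal_one]
  have hball : ∀ τ ∈ Metric.ball (0 : ℝ) α, φ₀ + τ • e ∈ Metric.closedBall φ₀ α := fun τ hτ =>
    Metric.ball_subset_closedBall (mem_ball_add_smul_single (by simpa using hτ))
  have hscore : ∫ y, pd (fun φ' => Real.log (f y φ')) i φ₀ ∂P =
      ∫ y, f y φ₀ * pd (fun φ' => Real.log (f y φ')) i φ₀ ∂ν := by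
    conv_lhs => rw [hf.law]
    rw [integral_withDensity_eq_integral_toReal_smul hm₀
      (Eventually.of_forall fun _ => ENNReal.ofReal_lt_top)]
    refine integral_congr_ae (Eventually.of_forall fun y => ?_)
    simp [ENNReal.toReal_ofReal (hf.nonneg φ₀ hφ₀ y)]
  have hmeas : AEStronglyMeasurable (fun y => pd (f y) i φ₀) ν := by
    have h1 : AEMeasurable (fun y => pd (fun φ' => Real.log (f y φ')) i φ₀)
        (ν.withDensity fun y => ((f y φ₀).toNNReal : ENNReal)) := by
      have := (hf.info_finite i).aestronglyMeasurable.aemeasurable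
      rw [hf.law] at this
      exact this
    rw [aemeasurable_withDensity_iff (hf.measurable φ₀ hφ₀).real_toNNReal] at h1
    refine (h1.congr ?_).aestronglyMeasurable
    filter_upwards [hfacts] with y hy
    rw [hy.1]
    simp [Real.coe_toNNReal _ (hf.nonneg φ₀ hφ₀ y)]
  have hfi : Integrable (fun y => f y φ₀) ν := by
    refine ⟨(hf.measurable φ₀ hφ₀).aestronglyMeasurable, ?_⟩
    rw [hasFiniteIntegral_iff_ofReal (Eventually.of_forall (hf.nonneg φ₀ hφ₀)),
      hf.lintegral_eq_one φ₀ hφ₀]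
    exact ENNReal.one_lt_top
  have hder := hasDerivAt_integral_of_dominated_loc_of_deriv_le (μ := ν) (𝕜 := ℝ) (x₀ := (0 : ℝ))
    (F := fun τ y => f y (φ₀ + τ • e)) (F' := fun τ y => pd (f y) i (φ₀ + τ • e))
    (bound := fun y => |F₁ y|) (Metric.ball_mem_nhds 0 hα)
    (by
      filter_upwards [Metric.ball_mem_nhds (0 : ℝ) hα] with τ hτ
      exact (hf.measurable _ (hball τ hτ)).aestronglyMeasurable)
    (by simpa using hfi) (by simpa using hmeas)
    (by filter_upwards [hfacts] with y hy τ hτ using (hy.2 τ hτ).1) hF₁.abs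
    (by filter_upwards [hfacts] with y hy τ hτ using (hy.2 τ hτ).2)
  have hconst : (fun τ : ℝ => ∫ y, f y (φ₀ + τ • e) ∂ν) =ᶠ[𝓝 0] fun _ => 1 := by
    filter_upwards [Metric.ball_mem_nhds (0 : ℝ) hα] with τ hτ
    exact hint _ (hball τ hτ)
  have h1 := hder.2.unique ((hasDerivAt_const (0 : ℝ) (1 : ℝ)).congr_of_eventuallyEq hconst)
  rw [hscore, ← h1]
  refine integral_congr_ae ?_
  filter_upwards [hfacts] with y hy
  simp [hy.1]

end Score

/-! ### Linearization of the Lagrange equations -/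

section LagrangeExpansion

lemma norm_toLp_le_sum_abs {κ : Type*} [Fintype κ] (z : κ → ℝ) :
    ‖(WithLp.toLp 2 z : EuclideanSpace ℝ κ)‖ ≤ ∑ i, |z i| := by
  rw [EuclideanSpace.norm_eq, Real.sqrt_le_left (Finset.sum_nonneg fun i _ => abs_nonneg _)]
  exact Finset.sum_sq_le_sq_sum_of_nonneg fun i _ => norm_nonneg _

lemma norm_toLp_mulVec_le {κ κ' : Type*} [Fintype κ] [Fintype κ'] (M : Matrix κ κ' ℝ)
    (w : κ' → ℝ) :
    ‖(WithLp.toLp 2 (M *ᵥ w) : EuclideanSpace ℝ κ)‖ ≤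
      (∑ i, ∑ j, |M i j|) * ∑ j, |w j| := by
  refine (norm_toLp_le_sum_abs _).trans ?_
  rw [Finset.sum_mul]
  refine Finset.sum_le_sum fun i _ => ?_
  rw [mulVec, dotProduct, Finset.sum_mul]
  refine (Finset.abs_sum_le_sum_abs _ _).trans (Finset.sum_le_sum fun j _ => ?_)
  rw [abs_mul]
  exact mul_le_mul_of_nonneg_left
    (Finset.single_le_sum (f := fun j => |w j|) (fun _ _ => abs_nonneg _) (Finset.mem_univ j))
    (abs_nonneg _)

variable {𝒳 : Type*} {r q t : ℕ}

lemma dist_phiPart_le (ω ω₀ : EuclideanSpace ℝ (Fin r ⊕ Fin q)) :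
    dist (phiPart ω) (phiPart ω₀) ≤ dist ω ω₀ := by
  rw [EuclideanSpace.dist_eq, EuclideanSpace.dist_eq]
  refine Real.sqrt_le_sqrt ?_
  rw [Fintype.sum_sum_type]
  exact le_add_of_nonneg_right (Finset.sum_nonneg fun _ _ => sq_nonneg _)

lemma dist_le_norm_errorVec (ω₀ ω : EuclideanSpace ℝ (Fin r ⊕ Fin q)) (lam : Fin t → ℝ) :
    dist ω ω₀ ≤ ‖errorVec ω₀ ω lam‖ := by
  rw [EuclideanSpace.dist_eq, EuclideanSpace.norm_eq]
  refine Real.sqrt_le_sqrt ?_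
  rw [Fintype.sum_sum_type (fun i => ‖(errorVec ω₀ ω lam) i‖ ^ 2)]
  refine le_add_of_le_of_nonneg (le_of_eq ?_) (Finset.sum_nonneg fun _ _ => sq_nonneg _)
  simp [errorVec, Real.dist_eq]

lemma abs_lam_le_norm_errorVec (ω₀ ω : EuclideanSpace ℝ (Fin r ⊕ Fin q)) (lam : Fin t → ℝ)
    (k : Fin t) : |lam k| ≤ ‖errorVec ω₀ ω lam‖ :=
  PiLp.norm_apply_le (errorVec ω₀ ω lam) (Sum.inr k)

/-- Constant in the bound of the residual of the linearized Lagrange equations. Its four terms come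
from the variation of the Jacobian of `h`, from the error in the Hessian, and from the remainders
in the expansions of the score and of `h`. -/
noncomputable def residualConst (r q t : ℕ) (κ₁ κ₂ : ℝ) : ℝ :=
  t * ((r + q) * (2 * |κ₂|)) + r + r * (r * (2 * κ₁)) + (r + q) * ((r + q) * (2 * |κ₂|))

variable {f : 𝒳 → EuclideanSpace ℝ (Fin r) → ℝ} {φ₀ : EuclideanSpace ℝ (Fin r)} {α κ₁ κ₂ δ : ℝ}
  {n : ℕ} {x : Fin n → 𝒳} {h : EuclideanSpace ℝ (Fin r ⊕ Fin q) → Fin t → ℝ}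
  {ω₀ ω : EuclideanSpace ℝ (Fin r ⊕ Fin q)} {lam : Fin t → ℝ}

/-- Second-order expansion of the averaged score around the true value. -/
lemma abs_score_expansion_le (hn : n ≠ 0) (hx : ∀ k, HasThirdPD f φ₀ α (x k))
    (h3 : ∀ φ ∈ Metric.closedBall φ₀ α, ∀ i j k,
      |(n : ℝ)⁻¹ * pd (pd (pd (logLik f x) i) j) k φ| < 2 * κ₁)
    {φ : EuclideanSpace ℝ (Fin r)} (hφ : φ ∈ Metric.ball φ₀ α) (i : Fin r) :
    |(n : ℝ)⁻¹ * score f x φ i - (n : ℝ)⁻¹ * score f x φ₀ i -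
        ∑ j, (n : ℝ)⁻¹ * hess f x φ₀ i j * (φ j - φ₀ j)| ≤
      r * (r * (2 * κ₁)) * dist φ φ₀ ^ 2 := by
  have hn0 : (0 : ℝ) < n := by exact_mod_cast Nat.pos_of_ne_zero hn
  have hsub : Metric.closedBall φ₀ (dist φ φ₀) ⊆ Metric.ball φ₀ α :=
    Metric.closedBall_subset_ball hφ
  have key := abs_sub_sub_sum_pd_le (G := pd (logLik f x) i) (c := φ₀) (v := φ)
    (L := n * (2 * κ₁)) (fun j w hw => (hasPD_pd_logLik hx i j (hsub hw)).1)
    (fun j k w hw => hasPD_pd_pd_logLik hx i j k (hsub hw))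
    (fun j k w hw => by
      have := (h3 w (Metric.ball_subset_closedBall (hsub hw)) i j k).le
      rw [abs_mul, abs_of_pos (inv_pos.2 hn0), inv_mul_le_iff₀ hn0] at this
      exact this)
  have hfac : (n : ℝ)⁻¹ * score f x φ i - (n : ℝ)⁻¹ * score f x φ₀ i -
        ∑ j, (n : ℝ)⁻¹ * hess f x φ₀ i j * (φ j - φ₀ j) =
      (n : ℝ)⁻¹ * (pd (logLik f x) i φ - pd (logLik f x) i φ₀ -
        ∑ j, pd (pd (logLik f x) i) j φ₀ * (φ j - φ₀ j)) := by
    simp only [score, hess, Matrix.of_apply, mul_sub, Finset.mul_sum, mul_assoc]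
  rw [hfac, abs_mul, abs_of_pos (inv_pos.2 hn0), inv_mul_le_iff₀ hn0]
  refine key.trans (le_of_eq ?_)
  rw [Fintype.card_fin]
  ring

lemma ConstraintConditions.abs_jac_sub_le (hh : ConstraintConditions h ω₀ α κ₂)
    (hω : ω ∈ Metric.closedBall ω₀ α) (k : Fin t) (i : Fin r ⊕ Fin q) :
    |pd (fun w => h w k) i ω - pd (fun w => h w k) i ω₀| ≤
      (r + q) * (2 * |κ₂|) * dist ω ω₀ := by
  have hsub : Metric.closedBall ω₀ (dist ω ω₀) ⊆ Metric.closedBall ω₀ α :=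
    Metric.closedBall_subset_closedBall hω
  have := abs_sub_le_of_abs_pd_le (G := pd (fun w => h w k) i) (c := ω₀) (v := ω)
    (L := 2 * |κ₂|) (fun j w hw => hh.exists_second_deriv k i j w (hsub hw))
    (fun j w hw => (hh.second_deriv_bound k i j w (hsub hw)).trans
      (mul_le_mul_of_nonneg_left (le_abs_self _) two_pos.le))
  simpa using this

lemma ConstraintConditions.abs_expansion_le (hh : ConstraintConditions h ω₀ α κ₂)
    (hω : ω ∈ Metric.closedBall ω₀ α) (k : Fin t) :
    |h ω k - h ω₀ k - ∑ i, pd (fun w => h w k) i ω₀ * (ω i - ω₀ i)| ≤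
      (r + q) * ((r + q) * (2 * |κ₂|)) * dist ω ω₀ ^ 2 := by
  have hsub : Metric.closedBall ω₀ (dist ω ω₀) ⊆ Metric.closedBall ω₀ α :=
    Metric.closedBall_subset_closedBall hω
  have := abs_sub_sub_sum_pd_le (G := fun w => h w k) (c := ω₀) (v := ω)
    (L := 2 * |κ₂|) (fun j w hw => hh.exists_deriv k j w (hsub hw))
    (fun i j w hw => hh.exists_second_deriv k i j w (hsub hw))
    (fun i j w hw => (hh.second_deriv_bound k i j w (hsub hw)).trans
      (mul_le_mul_of_nonneg_left (le_abs_self _) two_pos.le))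
  simpa using this

lemma abs_sum_sub_mul_lam_le {c : ℝ} (a b : Fin t → ℝ) (hab : ∀ k, |a k - b k| ≤ c) :
    |∑ k, (a k - b k) * lam k| ≤ t * c * ‖errorVec ω₀ ω lam‖ := by
  calc |∑ k, (a k - b k) * lam k| ≤ ∑ k, |(a k - b k) * lam k| :=
        Finset.abs_sum_le_sum_abs _ _
    _ ≤ ∑ _k : Fin t, c * ‖errorVec ω₀ ω lam‖ := by
        refine Finset.sum_le_sum fun k _ => ?_
        rw [abs_mul]
        exact mul_le_mul (hab k) (abs_lam_le_norm_errorVec ω₀ ω lam k) (abs_nonneg _)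
          ((abs_nonneg _).trans (hab k))
    _ = t * c * ‖errorVec ω₀ ω lam‖ := by simp [mul_assoc]

/-- A solution of the Lagrange equations within `δ` of the true value solves the linearized
equations up to an error of order `δ` times its own size. -/
lemma SolvesLagrange.abs_residual_le {B : Matrix (Fin r) (Fin r) ℝ} (hn : n ≠ 0)
    (hκ₁ : 0 ≤ κ₁) (hx : ∀ k, HasThirdPD f (phiPart ω₀) α (x k))
    (hess_eq : ∃ m : Matrix (Fin r) (Fin r) ℝ, (∀ i j, |m i j| ≤ 1) ∧
      (n : ℝ)⁻¹ • hess f x (phiPart ω₀) = -B + δ • m)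
    (h3 : ∀ φ ∈ Metric.closedBall (phiPart ω₀) α, ∀ i j k,
      |(n : ℝ)⁻¹ * pd (pd (pd (logLik f x) i) j) k φ| < 2 * κ₁)
    (hh : ConstraintConditions h ω₀ α κ₂) (hω₀ : h ω₀ = 0) (hδα : δ < α)
    (hω : ‖ω - ω₀‖ < δ) (hsol : SolvesLagrange f h x ω lam) (c : (Fin r ⊕ Fin q) ⊕ Fin t) :
    |(lagrangeMatrix B (jacJ h ω₀) (jacK h ω₀) *ᵥ (errorVec ω₀ ω lam).ofLp) c -
        Sum.elim (Sum.elim ((n : ℝ)⁻¹ • (score f x (phiPart ω₀)).ofLp) 0) 0 c| ≤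
      residualConst r q t κ₁ κ₂ * δ * ‖errorVec ω₀ ω lam‖ := by
  obtain ⟨m, hm, hM⟩ := hess_eq
  rw [← dist_eq_norm] at hω
  have hδ : 0 < δ := dist_nonneg.trans_lt hω
  have hωα : ω ∈ Metric.closedBall ω₀ α := (hω.trans hδα).le
  set V := ‖errorVec ω₀ ω lam‖ with hV
  have hV0 : 0 ≤ V := norm_nonneg _
  set d := dist ω ω₀ with hd
  have hd0 : 0 ≤ d := dist_nonneg
  have hdV : d ≤ V := dist_le_norm_errorVec ω₀ ω lam
  have hd2 : d ^ 2 ≤ δ * V := by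
    rw [pow_two]; exact mul_le_mul hω.le hdV hd0 hδ.le
  have hdVδ : d * V ≤ δ * V := mul_le_mul_of_nonneg_right hω.le hV0
  have hjac : ∀ i : Fin r ⊕ Fin q,
      |∑ k, (pd (fun w => h w k) i ω - pd (fun w => h w k) i ω₀) * lam k| ≤
        t * ((r + q) * (2 * |κ₂|)) * (δ * V) := by
    intro i
    refine (abs_sum_sub_mul_lam_le (ω₀ := ω₀) (ω := ω) (fun k => pd (fun w => h w k) i ω)
      (fun k => pd (fun w => h w k) i ω₀) fun k => hh.abs_jac_sub_le hωα k i).trans ?_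
    calc t * ((r + q) * (2 * |κ₂|) * d) * V = t * ((r + q) * (2 * |κ₂|)) * (d * V) := by ring
      _ ≤ _ := by gcongr
  have c1 : 0 ≤ (t : ℝ) * ((r + q) * (2 * |κ₂|)) * (δ * V) := by positivity
  have c2 : 0 ≤ (r : ℝ) * (δ * V) := by positivity
  have c3 : 0 ≤ (r : ℝ) * (r * (2 * κ₁)) * (δ * V) := by positivity
  have c4 : 0 ≤ ((r : ℝ) + q) * ((r + q) * (2 * |κ₂|)) * (δ * V) := by positivity
  have hconst : residualConst r q t κ₁ κ₂ * δ * V = t * ((r + q) * (2 * |κ₂|)) * (δ * V) +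
      r * (δ * V) + r * (r * (2 * κ₁)) * (δ * V) +
      (r + q) * ((r + q) * (2 * |κ₂|)) * (δ * V) := by
    rw [residualConst]; ring
  rw [hconst]
  match c with
  | Sum.inl (Sum.inl i) =>
    have hφd : dist (phiPart ω) (phiPart ω₀) ≤ d := dist_phiPart_le ω ω₀
    have hφ : phiPart ω ∈ Metric.ball (phiPart ω₀) α := (hφd.trans_lt hω).trans hδα
    have hR := abs_score_expansion_le hn hx h3 hφ i
    have hs := congrFun hsol.score_eq i
    simp only [Pi.add_apply, Pi.smul_apply, smul_eq_mul, Pi.zero_apply, mulVec, dotProduct] at hs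
    have hMij : ∀ j, (n : ℝ)⁻¹ * hess f x (phiPart ω₀) i j = -B i j + δ * m i j := fun j => by
      simpa using congrFun (congrFun hM i) j
    simp only [hMij] at hR
    have hmb : |∑ j, δ * m i j * (phiPart ω j - phiPart ω₀ j)| ≤ r * (δ * V) := by
      calc _ ≤ ∑ j, |δ * m i j * (phiPart ω j - phiPart ω₀ j)| :=
            Finset.abs_sum_le_sum_abs _ _
        _ ≤ ∑ _j : Fin r, δ * V := by
            refine Finset.sum_le_sum fun j _ => ?_
            rw [abs_mul, abs_mul, abs_of_pos hδ, mul_assoc]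
            refine mul_le_mul_of_nonneg_left ?_ hδ.le
            calc _ ≤ 1 * V := mul_le_mul (hm i j)
                  ((abs_sub_apply_le _ _ j).trans (hφd.trans hdV)) (abs_nonneg _) zero_le_one
              _ = V := one_mul V
        _ = r * (δ * V) := by simp
    have hR' : (r : ℝ) * (r * (2 * κ₁)) * dist (phiPart ω) (phiPart ω₀) ^ 2 ≤
        r * (r * (2 * κ₁)) * (δ * V) := by
      refine mul_le_mul_of_nonneg_left (le_trans ?_ hd2) (by positivity)
      exact pow_le_pow_left₀ dist_nonneg hφd 2
    have hid : (lagrangeMatrix B (jacJ h ω₀) (jacK h ω₀) *ᵥ (errorVec ω₀ ω lam).ofLp)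
          (Sum.inl (Sum.inl i)) -
        Sum.elim (Sum.elim ((n : ℝ)⁻¹ • (score f x (phiPart ω₀)).ofLp) 0) 0
          (Sum.inl (Sum.inl i) : (Fin r ⊕ Fin q) ⊕ Fin t) =
        ∑ k, (pd (fun w => h w k) (Sum.inl i) ω - pd (fun w => h w k) (Sum.inl i) ω₀) * lam k +
        ∑ j, δ * m i j * (phiPart ω j - phiPart ω₀ j) +
        ((n : ℝ)⁻¹ * score f x (phiPart ω) i - (n : ℝ)⁻¹ * score f x (phiPart ω₀) i -
          ∑ j, (-B i j + δ * m i j) * (phiPart ω j - phiPart ω₀ j)) := by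
      have hl : (lagrangeMatrix B (jacJ h ω₀) (jacK h ω₀) *ᵥ (errorVec ω₀ ω lam).ofLp)
          (Sum.inl (Sum.inl i)) = ∑ j, B i j * (phiPart ω j - phiPart ω₀ j) -
            ∑ k, pd (fun w => h w k) (Sum.inl i) ω₀ * lam k := by
        simp [lagrangeMatrix, mulVec, dotProduct, Fintype.sum_sum_type, errorVec, phiPart, jacJ,
          sub_eq_add_neg]
      rw [hl]
      simp only [add_mul, sub_mul, neg_mul, Finset.sum_add_distrib, Finset.sum_sub_distrib,
        Finset.sum_neg_distrib, Sum.elim_inl, Pi.smul_apply, smul_eq_mul]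
      simp only [jacJ, Matrix.of_apply] at hs
      linarith
    rw [hid]
    refine (abs_add_three _ _ _).trans ?_
    have := hjac (Sum.inl i)
    linarith
  | Sum.inl (Sum.inr l) =>
    have hs := congrFun hsol.multiplier_eq l
    simp only [Pi.zero_apply, mulVec, dotProduct, jacK, Matrix.of_apply] at hs
    have hl : (lagrangeMatrix B (jacJ h ω₀) (jacK h ω₀) *ᵥ (errorVec ω₀ ω lam).ofLp)
          (Sum.inl (Sum.inr l)) -
        Sum.elim (Sum.elim ((n : ℝ)⁻¹ • (score f x (phiPart ω₀)).ofLp) 0) 0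
          (Sum.inl (Sum.inr l) : (Fin r ⊕ Fin q) ⊕ Fin t) =
        ∑ k, (pd (fun w => h w k) (Sum.inr l) ω - pd (fun w => h w k) (Sum.inr l) ω₀) *
          lam k := by
      simp only [sub_mul, Finset.sum_sub_distrib, hs]
      simp [lagrangeMatrix, mulVec, dotProduct, Fintype.sum_sum_type, errorVec, jacK]
    rw [hl]
    have := hjac (Sum.inr l)
    linarith
  | Sum.inr k =>
    have hR := hh.abs_expansion_le hωα k
    have hl : (lagrangeMatrix B (jacJ h ω₀) (jacK h ω₀) *ᵥ (errorVec ω₀ ω lam).ofLp)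
          (Sum.inr k) -
        Sum.elim (Sum.elim ((n : ℝ)⁻¹ • (score f x (phiPart ω₀)).ofLp) 0) 0
          (Sum.inr k : (Fin r ⊕ Fin q) ⊕ Fin t) =
        h ω k - h ω₀ k - ∑ i, pd (fun w => h w k) i ω₀ * (ω i - ω₀ i) := by
      rw [hsol.constraint_eq, hω₀]
      simp [lagrangeMatrix, mulVec, dotProduct, Fintype.sum_sum_type, errorVec, jacJ, jacK]
      ring
    rw [hl]
    have : ((r : ℝ) + q) * ((r + q) * (2 * |κ₂|)) * d ^ 2 ≤
        (r + q) * ((r + q) * (2 * |κ₂|)) * (δ * V) :=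
      mul_le_mul_of_nonneg_left hd2 (by positivity)
    linarith

lemma residualConst_nonneg (r q t : ℕ) {κ₁ : ℝ} (hκ₁ : 0 ≤ κ₁) (κ₂ : ℝ) :
    0 ≤ residualConst r q t κ₁ κ₂ := by
  unfold residualConst
  positivity

/-- If `v` solves `M v = u` up to an entrywise error `c ‖v‖` with `c` small, then it is close to
the exact solution `N u`, relative to the size of that solution. -/
lemma norm_sub_toLp_mulVec_le {κ : Type*} [Fintype κ] [DecidableEq κ] {M N : Matrix κ κ ℝ}
    (hNM : N * M = 1) {v : EuclideanSpace ℝ κ} {u : κ → ℝ} {c : ℝ} (hc0 : 0 ≤ c)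
    (hres : ∀ i, |(M *ᵥ v.ofLp) i - u i| ≤ c * ‖v‖)
    (hc : (∑ i, ∑ j, |N i j|) * (Fintype.card κ * c) ≤ 1 / 2) :
    ‖v - WithLp.toLp 2 (N *ᵥ u)‖ ≤ 2 * ((∑ i, ∑ j, |N i j|) * (Fintype.card κ * c)) *
      ‖(WithLp.toLp 2 (N *ᵥ u) : EuclideanSpace ℝ κ)‖ := by
  set a := (∑ i, ∑ j, |N i j|) * (Fintype.card κ * c) with ha
  have h1 : v - WithLp.toLp 2 (N *ᵥ u) = WithLp.toLp 2 (N *ᵥ (M *ᵥ v.ofLp - u)) := by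
    rw [mulVec_sub, mulVec_mulVec, hNM, one_mulVec]
    rfl
  have h2 : ‖v - WithLp.toLp 2 (N *ᵥ u)‖ ≤ a * ‖v‖ := by
    rw [h1]
    refine (norm_toLp_mulVec_le N _).trans ?_
    rw [ha, mul_assoc]
    refine mul_le_mul_of_nonneg_left ?_
      (Finset.sum_nonneg fun i _ => Finset.sum_nonneg fun j _ => abs_nonneg _)
    refine (Finset.sum_le_sum fun i _ => hres i).trans (le_of_eq ?_)
    simp [mul_assoc]
  have h3 : ‖v‖ ≤ ‖v - WithLp.toLp 2 (N *ᵥ u)‖ +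
      ‖(WithLp.toLp 2 (N *ᵥ u) : EuclideanSpace ℝ κ)‖ := by
    simpa using norm_add_le (v - WithLp.toLp 2 (N *ᵥ u)) (WithLp.toLp 2 (N *ᵥ u))
  have hv := norm_nonneg v
  -- since `a ≤ 1 / 2`, the error term is absorbed into the left-hand side
  have h4 : ‖v‖ ≤ 2 * ‖(WithLp.toLp 2 (N *ᵥ u) : EuclideanSpace ℝ κ)‖ := by nlinarith
  have ha0 : 0 ≤ a := mul_nonneg
    (Finset.sum_nonneg fun i _ => Finset.sum_nonneg fun j _ => abs_nonneg _) (by positivity)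
  nlinarith

end LagrangeExpansion

/-! ### Asymptotic normality of the estimators -/

section Estimator

variable {𝒳 : Type*} [MeasurableSpace 𝒳] {r q t : ℕ} {ν P : Measure 𝒳}

/-- The blocks `[N m, N (m + 1))` cover the integers from `N 0` on, and late integers lie in late
blocks. -/
lemma exists_index_of_strictMono {N : ℕ → ℕ} (hN : StrictMono N) {m₀ n : ℕ} (hn : N m₀ ≤ n) :
    ∃ m, m₀ ≤ m ∧ N m ≤ n ∧ n < N (m + 1) := by
  have hb : ∀ m, N m ≤ n → m ≤ n := fun m hm => (hN.id_le m).trans hm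
  refine ⟨Nat.findGreatest (fun m => N m ≤ n) n, Nat.le_findGreatest (hb m₀ hn) hn,
    Nat.findGreatest_spec (P := fun m => N m ≤ n) (hb m₀ hn) hn, ?_⟩
  by_contra! hlt
  have := Nat.le_findGreatest (P := fun m => N m ≤ n) (hb _ hlt) hlt
  omega

lemma aemeasurable_errorVec {Ω : Type*} [MeasurableSpace Ω] {μ : Measure Ω}
    (ω₀ : EuclideanSpace ℝ (Fin r ⊕ Fin q)) {ω : Ω → EuclideanSpace ℝ (Fin r ⊕ Fin q)}
    {lam : Ω → Fin t → ℝ} (hω : AEMeasurable ω μ) (hlam : AEMeasurable lam μ) :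
    AEMeasurable (fun x => errorVec ω₀ (ω x) (lam x)) μ := by
  refine (WithLp.measurable_toLp 2 _).comp_aemeasurable (aemeasurable_pi_iff.2 ?_)
  rintro (i | k)
  · have h1 : Measurable fun w : EuclideanSpace ℝ (Fin r ⊕ Fin q) => w i - ω₀ i := by fun_prop
    exact h1.comp_aemeasurable hω
  · exact aemeasurable_pi_iff.1 hlam k

lemma ae_forall_hasThirdPD [IsProbabilityMeasure P]
    {f : 𝒳 → EuclideanSpace ℝ (Fin r) → ℝ} {φ₀ : EuclideanSpace ℝ (Fin r)} {α κ₁ : ℝ}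
    (hf : DensityConditions ν P f φ₀ α κ₁) (n : ℕ) :
    ∀ᵐ x ∂(Measure.pi fun _ : Fin n => P), ∀ k, HasThirdPD f φ₀ α (x k) :=
  ae_all_iff.2 fun k =>
    (measurePreserving_eval (fun _ : Fin n => P) k).quasiMeasurePreserving.ae hf.exists_deriv

variable [IsProbabilityMeasure P] {f : 𝒳 → EuclideanSpace ℝ (Fin r) → ℝ}
  {h : EuclideanSpace ℝ (Fin r ⊕ Fin q) → Fin t → ℝ}
  {ω₀ : EuclideanSpace ℝ (Fin r ⊕ Fin q)} {α κ₁ κ₂ : ℝ} {δ ε : ℕ → ℝ} {N : ℕ → ℕ}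
  {X : (n : ℕ) → Set (Fin n → 𝒳)}
  {ωHat : (n : ℕ) → (Fin n → 𝒳) → EuclideanSpace ℝ (Fin r ⊕ Fin q)}
  {lamHat : (n : ℕ) → (Fin n → 𝒳) → Fin t → ℝ}

/-- The estimation error is almost surely the linear function `firstCol` of the averaged score,
up to an arbitrarily small multiple of that score. -/
lemma IsEstimatorSequence.eventually_norm_sub_le
    (hest : IsEstimatorSequence P f h ω₀ α κ₁ δ ε N X ωHat lamHat)
    (hf : DensityConditions ν P f (phiPart ω₀) α κ₁) (hh : ConstraintConditions h ω₀ α κ₂)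
    (hω₀ : h ω₀ = 0) {η : ℝ} (hη : 0 < η) :
    ∀ᶠ n : ℕ in atTop, ∀ᵐ x ∂(Measure.pi fun _ : Fin n => P),
      ‖errorVec ω₀ (ωHat n x) (lamHat n x) - WithLp.toLp 2
          (firstCol (fisherInfo P f (phiPart ω₀)) (jacJ h ω₀) (jacK h ω₀) *ᵥ
            ((n : ℝ)⁻¹ • (score f x (phiPart ω₀)).ofLp))‖ ≤
        η * ∑ i, |(n : ℝ)⁻¹ * score f x (phiPart ω₀) i| := by
  set B := fisherInfo P f (phiPart ω₀) with hB
  set J := jacJ h ω₀ with hJ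
  set K := jacK h ω₀ with hK
  set S := ∑ i, ∑ j, |blockP B J K i j| with hS
  set mC := ∑ i, ∑ j, |firstCol B J K i j| with hmC
  set R := residualConst r q t κ₁ κ₂ with hR
  have hR0 : 0 ≤ R := residualConst_nonneg r q t hf.kappa_pos.le κ₂
  have hmC0 : 0 ≤ mC := Finset.sum_nonneg fun i _ => Finset.sum_nonneg fun j _ => abs_nonneg _
  have hPM : blockP B J K * lagrangeMatrix B J K = 1 :=
    mul_eq_one_comm.1 (lagrangeMatrix_mul_blockP hf.info_posDef hh.rank_J hh.rank_K)
  set D : ℝ → ℝ := fun d =>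
    S * (Fintype.card ((Fin r ⊕ Fin q) ⊕ Fin t) * (R * d)) with hD
  have hDlim : Tendsto (fun m => D (δ m)) atTop (𝓝 0) := by
    have := ((hest.delta_lim.const_mul R).const_mul
      (Fintype.card ((Fin r ⊕ Fin q) ⊕ Fin t) : ℝ)).const_mul S
    simpa only [mul_zero] using this
  have hDlim' : Tendsto (fun m => 2 * D (δ m) * mC) atTop (𝓝 0) := by
    simpa using (hDlim.const_mul 2).mul_const mC
  obtain ⟨m₀, hm₀⟩ := eventually_atTop.1
    ((hDlim.eventually_le_const (show (0 : ℝ) < 1 / 2 by norm_num)).and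
      (hDlim'.eventually_le_const hη))
  filter_upwards [eventually_ge_atTop (N m₀), eventually_ne_atTop 0] with n hn hn0
  obtain ⟨m, hm, hNm, hNm'⟩ := exists_index_of_strictMono hest.N_mono hn
  have hgood := hest.good m n hNm hNm'
  filter_upwards [ae_forall_hasThirdPD hf n] with x hx
  set w : Fin r → ℝ := (n : ℝ)⁻¹ • (score f x (phiPart ω₀)).ofLp with hw
  change _ ≤ η * ∑ i, |w i|
  rw [← blockP_mulVec]
  by_cases hxX : x ∈ X n
  · obtain ⟨hclose, hsol⟩ := hest.solves m n hNm hNm' x hxX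
    have hδα : δ m < α := (hest.delta_anti (Nat.zero_le m)).trans_lt hest.delta_lt
    have hres := hsol.abs_residual_le hn0 hf.kappa_pos.le hx (hgood.hess_eq x hxX)
      (hgood.third_lt x hxX) hh hω₀ hδα hclose
    refine (norm_sub_toLp_mulVec_le hPM (mul_nonneg hR0 (hest.delta_pos m).le) hres
      (hm₀ m hm).1).trans ?_
    rw [blockP_mulVec]
    have hD0 : 0 ≤ 2 * D (δ m) := mul_nonneg two_pos.le (mul_nonneg
      (Finset.sum_nonneg fun i _ => Finset.sum_nonneg fun j _ => abs_nonneg _)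
      (mul_nonneg (Nat.cast_nonneg _) (mul_nonneg hR0 (hest.delta_pos m).le)))
    calc _ ≤ 2 * D (δ m) * (mC * ∑ i, |w i|) :=
          mul_le_mul_of_nonneg_left (norm_toLp_mulVec_le _ _) hD0
      _ = 2 * D (δ m) * mC * ∑ i, |w i| := by ring
      _ ≤ η * ∑ i, |w i| := mul_le_mul_of_nonneg_right (hm₀ m hm).2
          (Finset.sum_nonneg fun i _ => abs_nonneg _)
  · have hlin := hest.linear n ((hest.N_mono.monotone (Nat.zero_le m)).trans hNm) x hxX
    have h0 : errorVec ω₀ (ωHat n x) (lamHat n x) -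
        WithLp.toLp 2 (blockP B J K *ᵥ Sum.elim (Sum.elim w 0) 0) = 0 := by
      rw [hw, ← hlin]
      simp
    rw [h0, norm_zero]
    exact mul_nonneg hη.le (Finset.sum_nonneg fun i _ => abs_nonneg _)

lemma IsEstimatorSequence.tendstoInDistribution (hα : 0 < α)
    (hest : IsEstimatorSequence P f h ω₀ α κ₁ δ ε N X ωHat lamHat)
    (hf : DensityConditions ν P f (phiPart ω₀) α κ₁) (hh : ConstraintConditions h ω₀ α κ₂)
    (hω₀ : h ω₀ = 0) :
    TendstoInDistribution
      (fun (n : ℕ) (x : Fin n → 𝒳) => √(n : ℝ) • errorVec ω₀ (ωHat n x) (lamHat n x))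
      atTop
      (id : EuclideanSpace ℝ ((Fin r ⊕ Fin q) ⊕ Fin t) → _)
      (fun n : ℕ => Measure.pi fun _ : Fin n => P)
      (multivariateGaussian 0
        (asympCov (fisherInfo P f (phiPart ω₀)) (jacJ h ω₀) (jacK h ω₀))) := by
  have hpsd := posSemidef_asympCov hf.info_posDef hh.rank_J hh.rank_K
  have hcov := asympCov_eq hf.info_posDef hh.rank_J hh.rank_K
  rw [hcov] at hpsd ⊢
  refine tendstoInDistribution_of_asymptotically_linear
    (s := fun y i => pd (fun φ' => Real.log (f y φ')) i (phiPart ω₀)) hf.info_finite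
    (hf.integral_score_eq_zero hα) (fun i j => rfl) hpsd
    (fun n => (aemeasurable_errorVec ω₀ (hest.aemeasurable_omega n)
      (hest.aemeasurable_lam n)).const_smul √(n : ℝ)) fun η hη => ?_
  filter_upwards [hest.eventually_norm_sub_le hf hh hω₀ hη, eventually_ne_atTop 0] with n hn hn0
  filter_upwards [hn, ae_forall_hasThirdPD hf n] with x hx hx3
  have hsqrt : √(n : ℝ) ≠ 0 := Real.sqrt_ne_zero'.2 (by exact_mod_cast Nat.pos_of_ne_zero hn0)
  have hw : ∀ i, (√(n : ℝ))⁻¹ * ∑ k, pd (fun φ' => Real.log (f (x k) φ')) i (phiPart ω₀) =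
      √(n : ℝ) * ((n : ℝ)⁻¹ * score f x (phiPart ω₀) i) := by
    intro i
    have h1 : score f x (phiPart ω₀) i =
        ∑ k, pd (fun φ' => Real.log (f (x k) φ')) i (phiPart ω₀) :=
      pd_logLik hx3 i (Metric.mem_closedBall_self hα.le)
    have h2 : (n : ℝ)⁻¹ = (√(n : ℝ))⁻¹ * (√(n : ℝ))⁻¹ := by
      rw [← mul_inv, Real.mul_self_sqrt n.cast_nonneg]
    rw [h1, h2, mul_assoc, mul_inv_cancel_left₀ hsqrt]
  simp only [hw]
  have hvec : (fun i => √(n : ℝ) * ((n : ℝ)⁻¹ * score f x (phiPart ω₀) i)) =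
      √(n : ℝ) • ((n : ℝ)⁻¹ • (score f x (phiPart ω₀)).ofLp) := rfl
  rw [hvec, mulVec_smul, WithLp.toLp_smul, ← smul_sub, norm_smul, Real.norm_eq_abs,
    abs_of_nonneg (Real.sqrt_nonneg _)]
  simp only [abs_mul √(n : ℝ), abs_of_nonneg (Real.sqrt_nonneg (n : ℝ))]
  rw [← Finset.mul_sum, mul_left_comm]
  exact mul_le_mul_of_nonneg_left hx (Real.sqrt_nonneg _)

end Estimator

end PartialID

theorem theorem2 {𝒳 : Type*} [MeasurableSpace 𝒳] {r q t : ℕ} (hqt : q ≤ t) (htr : t ≤ r)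
    (ν P : Measure 𝒳) [IsProbabilityMeasure P]
    (f : 𝒳 → EuclideanSpace ℝ (Fin r) → ℝ)
    (h : EuclideanSpace ℝ (Fin r ⊕ Fin q) → Fin t → ℝ)
    (ω₀ : EuclideanSpace ℝ (Fin r ⊕ Fin q)) (hω₀ : h ω₀ = 0)
    (α κ₁ κ₂ : ℝ) (hα : 0 < α)
    (hf : PartialID.DensityConditions ν P f (PartialID.phiPart ω₀) α κ₁)
    (hh : PartialID.ConstraintConditions h ω₀ α κ₂)
    (δ ε : ℕ → ℝ) (N : ℕ → ℕ) (X : (n : ℕ) → Set (Fin n → 𝒳))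
    (ωHat : (n : ℕ) → (Fin n → 𝒳) → EuclideanSpace ℝ (Fin r ⊕ Fin q))
    (lamHat : (n : ℕ) → (Fin n → 𝒳) → Fin t → ℝ)
    (hest : PartialID.IsEstimatorSequence P f h ω₀ α κ₁ δ ε N X ωHat lamHat)
    (B : Matrix (Fin r) (Fin r) ℝ) (hB : B = PartialID.fisherInfo P f (PartialID.phiPart ω₀))
    (J : Matrix (Fin r) (Fin t) ℝ) (hJ : J = PartialID.jacJ h ω₀)
    (K : Matrix (Fin q) (Fin t) ℝ) (hK : K = PartialID.jacK h ω₀) :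
    IsUnit (PartialID.lagrangeMatrix B J K) ∧
    (PartialID.lagrangeMatrix B J K)⁻¹ = PartialID.blockP B J K ∧
    (PartialID.asympCov B J K).PosSemidef ∧
    TendstoInDistribution
      (fun (n : ℕ) (x : Fin n → 𝒳) => √(n : ℝ) • PartialID.errorVec ω₀ (ωHat n x) (lamHat n x))
      atTop
      (id : EuclideanSpace ℝ ((Fin r ⊕ Fin q) ⊕ Fin t) → _)
      (fun n : ℕ => Measure.pi fun _ : Fin n => P)
      (multivariateGaussian 0 (PartialID.asympCov B J K)) := by
  subst hB hJ hK
  have hMP := PartialID.lagrangeMatrix_mul_blockP hf.info_posDef hh.rank_J hh.rank_K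
  exact ⟨IsUnit.of_mul_eq_one _ hMP, Matrix.inv_eq_right_inv hMP,
    PartialID.posSemidef_asympCov hf.info_posDef hh.rank_J hh.rank_K,
    hest.tendstoInDistribution hα hf hh hω₀⟩
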